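/- **Theorem.** Let $\mathfrak g$ be a real Lie algebra, $W$ a finite-dimensional real vector space, and $\rho:\mathfrak g\to \mathrm{End}(W)$ a faithful representation. Let $W^*$ be the dual representation, $(x\cdot f)(w)=-f(\rho(x)w)$. Assume that there is a symmetric bilinear $\mathfrak g$-equivariant map $\wedge: W\times W\to W^*$, i.e. $x\cdot(u\wedge v)=(\rho(x)u)\wedge v+u\wedge(\rho(x)v)$ for all $x\in\mathfrak g$ and $u,v\in W$, which does not vanish identically on $P\times P$ for any two-dimensional subspace $P\subset W$. 1. Suppose that $\mathfrak g$ is isomorphic to $\mathfrak{sl}_3(\mathbf R)$. Let $E=\mathbf R^3$ be the standard representation, $\mathrm{Sym}_2(E^*)$ the representation on the space of quadratic forms on $E$, and $T$ the trivial one-dimensional representation. Then for every isomorphism $\mathfrak g\simeq\mathfrak{sl}_3(\mathbf R)$, used to regard these as representations of $\mathfrak g$, there are integers $k,m\ge 0$ such that $W$ is isomorphic, as a representation of $\mathfrak g$, to $$\mathrm{Sym}_2(E^*)\oplus E^k\oplus T^m$$ or to the dual of this representation. 2. Suppose that $\mathfrak g$ is isomorphic, as a real Lie algebra, to $\mathfrak{sl}_3(\mathbf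 C)$. Let $E_{\mathbf C}=\mathbf C^3$ be the standard representation, $\overline{E_{\mathbf C}}$ its complex conjugate ($x$ acts on $\mathbf C^3$ by the matrix $\overline x$), $\mathrm{Her}(E_{\mathbf C}^*)$ the representation on the real vector space of hermitian forms on $E_{\mathbf C}$, $(x\cdot H)(v,w)=-H(xv,w)-H(v,xw)$, and $T$ the trivial one-dimensional real representation; all are regarded as real representations. Then for every isomorphism $\mathfrak g\simeq\mathfrak{sl}_3(\mathbf C)$ of real Lie algebras, used to regard these as representations of $\mathfrak g$, there are integers $k,l,m\ge 0$ and an automorphism $\sigma$ of the real Lie algebra $\mathfrak g$ such that the representation $\rho\circ\sigma$ of $\mathfrak g$ on $W$ is isomorphic to $$\mathrm{Her}(E_{\mathbf C}^*)\oplus E_{\mathbf C}^k\oplus\overline{E_{\mathbf C}}^{\,l}\oplus T^m .$$ (In both cases $\mathfrak g$ is automatically semisimple of real rank $2$.) -/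

import Mathlib

open Matrix LieAlgebra.SpecialLinear
open scoped ComplexConjugate

attribute [local instance] LieRing.ofAssociativeRing

noncomputable section

namespace RepSl3

/-- The complex Lie algebra of traceless complex `3 × 3` matrices, regarded as a real Lie algebra
by restriction of scalars. -/
instance slComplexReal : LieAlgebra ℝ (sl (Fin 3) ℂ) where
  lie_smul t x y := Subtype.ext (lie_smul t x.1 y.1)

/-! ### Real representations, their duals, direct sums, powers and isomorphisms

A representation of a real Lie algebra `g` on a real vector space `V` is a morphism of real
Lie algebras `g →ₗ⁅ℝ⁆ Module.End ℝ V`. -/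

section General

variable {g : Type*} [LieRing g] [LieAlgebra ℝ g]
variable {V : Type*} [AddCommGroup V] [Module ℝ V]
variable {V' : Type*} [AddCommGroup V'] [Module ℝ V']

/-- The dual representation: `(x · f) v = - f (x · v)`. -/
def dualRep (ρ : g →ₗ⁅ℝ⁆ Module.End ℝ V) : g →ₗ⁅ℝ⁆ Module.End ℝ (Module.Dual ℝ V) where
  toFun x :=
    { toFun := fun f => -(f ∘ₗ ρ x)
      map_add' := fun f f' => by ext v; simp; ring
      map_smul' := fun t f => by ext v; simp }
  map_add' x y := by ext f v; simp; ring
  map_smul' t x := by ext f v; simp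
  map_lie' {x y} := by ext f v; simp [LieRing.of_associative_ring_bracket]

/-- The direct sum of two representations. -/
def prodRep (ρ : g →ₗ⁅ℝ⁆ Module.End ℝ V) (σ : g →ₗ⁅ℝ⁆ Module.End ℝ V') :
    g →ₗ⁅ℝ⁆ Module.End ℝ (V × V') where
  toFun x := (ρ x).prodMap (σ x)
  map_add' x y := by ext v <;> simp
  map_smul' t x := by ext v <;> simp
  map_lie' {x y} := by ext v <;> simp [LieRing.of_associative_ring_bracket]

/-- The direct sum of `k` copies of a representation. -/
def powRep (k : ℕ) (ρ : g →ₗ⁅ℝ⁆ Module.End ℝ V) : g →ₗ⁅ℝ⁆ Module.End ℝ (Fin k → V) where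
  toFun x := LinearMap.pi fun i => ρ x ∘ₗ LinearMap.proj i
  map_add' x y := by ext v i; simp
  map_smul' t x := by ext v i; simp
  map_lie' {x y} := by
    refine LinearMap.ext fun v => funext fun i => ?_
    simp [LieRing.of_associative_ring_bracket]

variable (g) in
/-- The trivial one-dimensional real representation `T`. -/
def trivRep : g →ₗ⁅ℝ⁆ Module.End ℝ ℝ := 0

/-- Isomorphism of real representations of `g`: a `g`-equivariant real linear bijection. -/
def RepIso (ρ : g →ₗ⁅ℝ⁆ Module.End ℝ V) (σ : g →ₗ⁅ℝ⁆ Module.End ℝ V') : Prop :=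
  ∃ e : V ≃ₗ[ℝ] V', ∀ (x : g) (v : V), e (ρ x v) = σ x (e v)

end General

/-! ### Representations of `sl₃(ℝ)` -/

/-- The standard representation `E = ℝ³` of `sl₃(ℝ)`. -/
def stdR : sl (Fin 3) ℝ →ₗ⁅ℝ⁆ Module.End ℝ (Fin 3 → ℝ) where
  toFun x := Matrix.mulVecLin x.1
  map_add' x y := by ext v; simp
  map_smul' t x := by ext v; simp
  map_lie' {x y} := by
    refine LinearMap.ext fun v => ?_
    simp [LieRing.of_associative_ring_bracket]

/-- The infinitesimal action of a matrix `x` on quadratic forms: with `b` the polar form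
`b(v, w) = q(v + w) - q(v) - q(w)`, one has `(x · q)(v) = - b(x v, v)`, the derivative at `t = 0`
of `q(exp(-t x) v)`. -/
def quadAct (x : Matrix (Fin 3) (Fin 3) ℝ) (q : QuadraticForm ℝ (Fin 3 → ℝ)) :
    QuadraticForm ℝ (Fin 3 → ℝ) :=
  -LinearMap.BilinMap.toQuadraticMap (q.polarBilin ∘ₗ x.mulVecLin)

@[simp] lemma quadAct_apply (x : Matrix (Fin 3) (Fin 3) ℝ) (q : QuadraticForm ℝ (Fin 3 → ℝ))
    (v : Fin 3 → ℝ) : quadAct x q v = -q.polarBilin (x *ᵥ v) v := rfl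

/-- The representation of `sl₃(ℝ)` on `Sym₂(E*)`, the space of quadratic forms on `E = ℝ³`. -/
def symR : sl (Fin 3) ℝ →ₗ⁅ℝ⁆ Module.End ℝ (QuadraticForm ℝ (Fin 3 → ℝ)) where
  toFun x :=
    { toFun := quadAct x.1
      map_add' := fun q q' => QuadraticMap.ext fun v => by
        simp [QuadraticMap.polar]; ring
      map_smul' := fun t q => QuadraticMap.ext fun v => by
        simp [QuadraticMap.polar]; ring }
  map_add' x y := LinearMap.ext fun q => QuadraticMap.ext fun v => by
    change -q.polarBilin ((x.1 + y.1) *ᵥ v) v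
      = -q.polarBilin (x.1 *ᵥ v) v + -q.polarBilin (y.1 *ᵥ v) v
    simp only [Matrix.add_mulVec, map_add, LinearMap.add_apply]; ring
  map_smul' t x := LinearMap.ext fun q => QuadraticMap.ext fun v => by
    change -q.polarBilin ((t • x.1) *ᵥ v) v = t * -q.polarBilin (x.1 *ᵥ v) v
    simp only [Matrix.smul_mulVec, map_smul, LinearMap.smul_apply, smul_eq_mul]; ring
  map_lie' {x y} := LinearMap.ext fun q => QuadraticMap.ext fun v => by
    have hpol : ∀ (z : Matrix (Fin 3) (Fin 3) ℝ) (u w : Fin 3 → ℝ),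
        (quadAct z q).polarBilin u w
          = -q.polarBilin (z *ᵥ u) w - q.polarBilin (z *ᵥ w) u := fun z u w => by
      rw [QuadraticMap.polarBilin_apply_apply]
      simp only [QuadraticMap.polar, quadAct_apply, Matrix.mulVec_add, map_add,
        LinearMap.add_apply]
      ring
    have hcomm : q.polarBilin (x.1 *ᵥ v) (y.1 *ᵥ v) = q.polarBilin (y.1 *ᵥ v) (x.1 *ᵥ v) :=
      QuadraticMap.polar_comm q _ _
    change -q.polarBilin ((x.1 * y.1 - y.1 * x.1) *ᵥ v) v
      = -(quadAct y.1 q).polarBilin (x.1 *ᵥ v) v - -(quadAct x.1 q).polarBilin (y.1 *ᵥ v) v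
    rw [hpol, hpol, hcomm]
    simp only [Matrix.sub_mulVec, Matrix.mulVec_mulVec, map_sub, LinearMap.sub_apply]; ring

/-! ### Real representations of `sl₃(ℂ)` -/

/-- The standard representation `E_ℂ = ℂ³` of `sl₃(ℂ)`, regarded as a real representation. -/
def stdC : sl (Fin 3) ℂ →ₗ⁅ℝ⁆ Module.End ℝ (Fin 3 → ℂ) where
  toFun x := (Matrix.mulVecLin x.1).restrictScalars ℝ
  map_add' x y := by ext v; simp
  map_smul' t x := LinearMap.ext fun v => by simp
  map_lie' {x y} := LinearMap.ext fun v => by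
    simp [LieRing.of_associative_ring_bracket]

/-- The complex conjugate of the standard representation: `x` acts on `ℂ³` through the matrix
with complex conjugate entries. -/
def conjStdC : sl (Fin 3) ℂ →ₗ⁅ℝ⁆ Module.End ℝ (Fin 3 → ℂ) where
  toFun x := (Matrix.mulVecLin (x.1.map conj)).restrictScalars ℝ
  map_add' x y := LinearMap.ext fun v => by
    simp [Matrix.map_add]
  map_smul' t x := LinearMap.ext fun v => by
    have h : ((t • x.1).map conj : Matrix (Fin 3) (Fin 3) ℂ) = t • x.1.map conj := by
      ext i j; simp
    simp [h]
  map_lie' {x y} := LinearMap.ext fun v => by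
    have h : ((x.1 * y.1 - y.1 * x.1).map conj : Matrix (Fin 3) (Fin 3) ℂ)
        = x.1.map conj * y.1.map conj - y.1.map conj * x.1.map conj := by
      ext i j; simp [Matrix.mul_apply]
    simp [LieRing.of_associative_ring_bracket, h]

/-- The hermitian forms on `E_ℂ = ℂ³` (conjugate linear in the first variable, linear in the
second one), as a real subspace of the space of sesquilinear forms. -/
def herSubmodule : Submodule ℝ ((Fin 3 → ℂ) →ₗ⋆[ℂ] (Fin 3 → ℂ) →ₗ[ℂ] ℂ) where
  carrier := {H | ∀ v w, H v w = conj (H w v)}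
  add_mem' := fun {H H'} h h' v w => by
    simp only [LinearMap.add_apply, map_add]; rw [h v w, h' v w]
  zero_mem' := fun v w => by simp
  smul_mem' := fun t H h v w => by
    simp only [LinearMap.smul_apply, Complex.real_smul, map_mul, Complex.conj_ofReal]
    rw [h v w]

/-- `Her(E_ℂ*)`: the real vector space of hermitian forms on `E_ℂ = ℂ³`. -/
def HerForms : Type := herSubmodule

instance : AddCommGroup HerForms := Submodule.addCommGroup herSubmodule

instance : Module ℝ HerForms := Submodule.module herSubmodule

/-- The action of a matrix on sesquilinear forms:
`(x · H)(v, w) = - H(x v, w) - H(v, x w)`. -/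
def sesqAct (x : Matrix (Fin 3) (Fin 3) ℂ) (H : (Fin 3 → ℂ) →ₗ⋆[ℂ] (Fin 3 → ℂ) →ₗ[ℂ] ℂ) :
    (Fin 3 → ℂ) →ₗ⋆[ℂ] (Fin 3 → ℂ) →ₗ[ℂ] ℂ :=
  -(H ∘ₛₗ x.mulVecLin) - H.compl₂ x.mulVecLin

@[simp] lemma sesqAct_apply (x : Matrix (Fin 3) (Fin 3) ℂ)
    (H : (Fin 3 → ℂ) →ₗ⋆[ℂ] (Fin 3 → ℂ) →ₗ[ℂ] ℂ) (v w : Fin 3 → ℂ) :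
    sesqAct x H v w = -H (x *ᵥ v) w - H v (x *ᵥ w) := rfl

/-- The real representation of `sl₃(ℂ)` on `Her(E_ℂ*)`. -/
def herC : sl (Fin 3) ℂ →ₗ⁅ℝ⁆ Module.End ℝ HerForms where
  toFun x :=
    { toFun := fun H => ⟨sesqAct x.1 H.1, fun v w => by
        simp only [sesqAct_apply, map_sub, map_neg]
        rw [H.2 (x.1 *ᵥ v) w, H.2 v (x.1 *ᵥ w)]; ring⟩
      map_add' := fun H H' => Subtype.ext <| LinearMap.ext₂ fun v w => by
        change -(H.1 (x.1 *ᵥ v) w + H'.1 (x.1 *ᵥ v) w) - (H.1 v (x.1 *ᵥ w) + H'.1 v (x.1 *ᵥ w))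
          = (-H.1 (x.1 *ᵥ v) w - H.1 v (x.1 *ᵥ w)) + (-H'.1 (x.1 *ᵥ v) w - H'.1 v (x.1 *ᵥ w))
        ring
      map_smul' := fun t H => Subtype.ext <| LinearMap.ext₂ fun v w => by
        change -((t : ℂ) * H.1 (x.1 *ᵥ v) w) - (t : ℂ) * H.1 v (x.1 *ᵥ w)
          = (t : ℂ) * (-H.1 (x.1 *ᵥ v) w - H.1 v (x.1 *ᵥ w))
        ring }
  map_add' x y := LinearMap.ext fun H => Subtype.ext <| LinearMap.ext₂ fun v w => by
    change -H.1 ((x.1 + y.1) *ᵥ v) w - H.1 v ((x.1 + y.1) *ᵥ w)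
      = (-H.1 (x.1 *ᵥ v) w - H.1 v (x.1 *ᵥ w)) + (-H.1 (y.1 *ᵥ v) w - H.1 v (y.1 *ᵥ w))
    simp only [Matrix.add_mulVec, map_add, LinearMap.add_apply]; ring
  map_smul' t x := LinearMap.ext fun H => Subtype.ext <| LinearMap.ext₂ fun v w => by
    change -H.1 (((t : ℂ) • x.1) *ᵥ v) w - H.1 v (((t : ℂ) • x.1) *ᵥ w)
      = (t : ℂ) * (-H.1 (x.1 *ᵥ v) w - H.1 v (x.1 *ᵥ w))
    simp only [Matrix.smul_mulVec, LinearMap.map_smulₛₗ, LinearMap.smul_apply, smul_eq_mul,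
      Complex.conj_ofReal, RingHom.id_apply]
    ring
  map_lie' {x y} := LinearMap.ext fun H => Subtype.ext <| LinearMap.ext₂ fun v w => by
    change -H.1 ((x.1 * y.1 - y.1 * x.1) *ᵥ v) w - H.1 v ((x.1 * y.1 - y.1 * x.1) *ᵥ w)
      = (-(-H.1 (y.1 *ᵥ (x.1 *ᵥ v)) w - H.1 (x.1 *ᵥ v) (y.1 *ᵥ w))
          - (-H.1 (y.1 *ᵥ v) (x.1 *ᵥ w) - H.1 v (y.1 *ᵥ (x.1 *ᵥ w))))
        - (-(-H.1 (x.1 *ᵥ (y.1 *ᵥ v)) w - H.1 (y.1 *ᵥ v) (x.1 *ᵥ w))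
          - (-H.1 (x.1 *ᵥ v) (y.1 *ᵥ w) - H.1 v (x.1 *ᵥ (y.1 *ᵥ w))))
    simp only [Matrix.sub_mulVec, Matrix.mulVec_mulVec, map_sub, LinearMap.sub_apply]; ring

/-! ### The two model representations -/

/-- The representation `Sym₂(E*) ⊕ E^k ⊕ T^m` of `sl₃(ℝ)`. -/
def modelR (k m : ℕ) :
    sl (Fin 3) ℝ →ₗ⁅ℝ⁆ Module.End ℝ (QuadraticForm ℝ (Fin 3 → ℝ) × (Fin k → Fin 3 → ℝ) × (Fin m → ℝ)) :=
  prodRep symR (prodRep (powRep k stdR) (powRep m (trivRep (sl (Fin 3) ℝ))))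

/-- The real representation `Her(E_ℂ*) ⊕ E_ℂ^k ⊕ (conjugate of E_ℂ)^l ⊕ T^m` of `sl₃(ℂ)`. -/
def modelC (k l m : ℕ) :
    sl (Fin 3) ℂ →ₗ⁅ℝ⁆ Module.End ℝ
      (HerForms × (Fin k → Fin 3 → ℂ) × (Fin l → Fin 3 → ℂ) × (Fin m → ℝ)) :=
  prodRep herC (prodRep (powRep k stdC)
    (prodRep (powRep l conjStdC) (powRep m (trivRep (sl (Fin 3) ℂ)))))

end RepSl3

end

/-!
The two cases are treated together, with `𝕜 = ℝ` or `𝕜 = ℂ` and real representations throughout.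
A representation of `sl₃(𝕜)` is extended to `gl₃(𝕜)` by letting the scalar matrices
act by zero, so that the matrix units are available; only the real diagonal matrices are used to
define weights. Weights are pairs `(a, b)` of eigenvalues of `E₀₀ - E₁₁` and `E₁₁ - E₂₂`, so that
`Sym₂(E*)` and `Her(E*)` have the extremal weights `-2ε₀ = (-2, 0)`, `-2ε₁ = (2, -2)`,
`-2ε₂ = (0, 2)`.

*Weights.* The theory of `sl₂` (`IsSl2Rep.iSup_eigenspace_h_eq_top`,
`IsSl2Rep.pow_f_apply_ne_zero`) decomposes `W` into weight spaces with integral weights, permuted by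
the Weyl group. The product sends vectors of weights `λ` and `μ` to a functional that sees only the
weight space of `-λ - μ`. As no plane has zero product, for any two independent weight vectors one
of `-2λ`, `-λ - μ`, `-2μ` is a weight. Applied to a weight of maximal length and a neighbour, this
leaves only the extremal weights `-εᵢ` or `-2εᵢ`, up to the twist by `x ↦ -xᵀ`. The weights `-εᵢ`
are excluded since there the product is an invariant trilinear form, symmetric in two arguments,
that vanishes on vectors of the three different extremal weights. For `-2εᵢ` the same principle shows
that the remaining weights are `εᵢ` and `0`, and that `-2ε₂` has multiplicity one. This is
`IsCup.hasModelWeights`.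

*Reconstruction.* Let `v` span the weight space of `-2ε₂`. For `𝕜 = ℂ`, multiplicity one forces
`z(E₁₁ - E₂₂)` to act on `v` by `2 Re z`, and all the relations of `Her(E*)` among the vectors
`E₂ₚ(z) E₂ᵣ(w) v` follow (`HasModelWeights.cartanAct_highest₁₂`, `IsHighest.lower_lower`,
`IsHighest.lower₀_lower₁`). Hence an explicit formula defines an equivariant map `hermMap` from the
hermitian matrices to `W`. Likewise each vector of weight `ε₀` killed by `E₁₂` gives an equivariant
map `stdMap` from `E`; these vectors form a `𝕜`-vector space under `z(E₀₀ - E₁₁)`, whose bases give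
the summand `E^k`. The weight space of `0` is a trivial representation. Together these maps form an
isomorphism (`HasModelWeights.exists_equiv`), without any appeal to complete reducibility.

*The twist.* For `𝕜 = ℝ`, the model twisted by `x ↦ -xᵀ` is isomorphic to the dual of the model
through a positive definite form (`modelForm`). For `𝕜 = ℂ`, the twist is the automorphism `σ`. Since `E` and its conjugate are
isomorphic as real representations, no conjugate summand is needed.
-/

namespace RepSl3

/-! ### Finite-dimensional representations of `sl₂` -/

section Sl2

variable {K V : Type*} [Field K] [AddCommGroup V] [Module K V]

/-- Endomorphisms `h, e, f` satisfying the relations `[h, e] = 2e`, `[h, f] = -2f`, `[e, f] = h`.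
Unlike in `IsSl2Triple`, the triple may be zero. -/
structure IsSl2Rep (h e f : Module.End K V) : Prop where
  h_e : ∀ w, h (e w) = e (h w) + (2 : K) • e w
  h_f : ∀ w, h (f w) = f (h w) - (2 : K) • f w
  e_f : ∀ w, e (f w) = f (e w) + h w

namespace IsSl2Rep

variable {h e f : Module.End K V}

lemma symm (t : IsSl2Rep h e f) : IsSl2Rep (-h) f e where
  h_e w := by simp [t.h_f]; abel
  h_f w := by simp [t.h_e]; abel
  e_f w := by simp [t.e_f]

lemma h_pow_e (t : IsSl2Rep h e f) (k : ℕ) (w : V) :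
    h ((e ^ k) w) = (e ^ k) (h w) + (2 * k : K) • (e ^ k) w := by
  induction k with
  | zero => simp
  | succ k ih =>
    rw [pow_succ', Module.End.mul_apply, t.h_e, ih, map_add, map_smul, Module.End.mul_apply]
    push_cast
    module

lemma h_pow_f (t : IsSl2Rep h e f) (k : ℕ) (w : V) :
    h ((f ^ k) w) = (f ^ k) (h w) - (2 * k : K) • (f ^ k) w := by
  have := t.symm.h_pow_e k w
  simp only [LinearMap.neg_apply, map_neg] at this
  rw [neg_eq_iff_eq_neg] at this
  rw [this]
  abel

lemma pow_e_f (t : IsSl2Rep h e f) (k : ℕ) (w : V) :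
    (e ^ (k + 1)) (f w) =
      f ((e ^ (k + 1)) w) + (k + 1 : K) • ((e ^ k) (h w) + (k : K) • (e ^ k) w) := by
  induction k with
  | zero => simp [t.e_f]
  | succ k ih =>
    rw [pow_succ', Module.End.mul_apply, ih, map_add, t.e_f, map_smul, map_add, map_smul,
      t.h_pow_e]
    simp only [pow_succ' e, Module.End.mul_apply]
    push_cast
    module

/-- Each nonzero power of `e` is an eigenvector of `ad h`, with pairwise distinct eigenvalues. -/
lemma isNilpotent_e [CharZero K] [FiniteDimensional K V] (t : IsSl2Rep h e f) :
    IsNilpotent e := by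
  by_contra hn
  have hn' : ∀ k, e ^ k ≠ 0 := fun k hk => hn ⟨k, hk⟩
  let D : Module.End K (Module.End K V) := LinearMap.mulLeft K h - LinearMap.mulRight K h
  have hli := Module.End.eigenvectors_linearIndependent' D (fun k : ℕ => (2 * k : K))
    (fun a b hab => by simpa using hab) (fun k => e ^ k) (fun k => by
      refine ⟨Module.End.mem_eigenspace_iff.2 ?_, hn' k⟩
      ext w
      simp [D, t.h_pow_e])
  exact Set.infinite_univ (Set.finite_univ_iff.2 hli.finite)

variable (h e f) in
/-- The Casimir operator `4fe + h(h + 2)`, normalized to take the value `j(j + 2)` on the simple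
module of highest weight `j`. -/
def casimir : Module.End K V := (4 : K) • (f * e) + h * h + (2 : K) • h

lemma casimir_apply (w : V) :
    casimir h e f w = (4 : K) • f (e w) + h (h w) + (2 : K) • h w := rfl

lemma casimir_e (t : IsSl2Rep h e f) (w : V) :
    casimir h e f (e w) = e (casimir h e f w) := by
  simp only [casimir_apply, map_add, map_smul, t.h_e, t.e_f]
  module

lemma casimir_f (t : IsSl2Rep h e f) (w : V) :
    casimir h e f (f w) = f (casimir h e f w) := by
  simp only [casimir_apply, map_add, map_sub, map_smul, t.h_f, t.e_f]
  module

lemma casimir_h (t : IsSl2Rep h e f) (w : V) :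
    casimir h e f (h w) = h (casimir h e f w) := by
  simp only [casimir_apply, map_add, map_smul, t.h_f, t.h_e]
  module

lemma casimir_pow_e (t : IsSl2Rep h e f) (k : ℕ) (w : V) :
    casimir h e f ((e ^ k) w) = (e ^ k) (casimir h e f w) := by
  induction k with
  | zero => simp
  | succ k ih => rw [pow_succ', Module.End.mul_apply, t.casimir_e, ih, Module.End.mul_apply]

lemma casimir_pow_f (t : IsSl2Rep h e f) (k : ℕ) (w : V) :
    casimir h e f ((f ^ k) w) = (f ^ k) (casimir h e f w) := by
  induction k with
  | zero => simp
  | succ k ih => rw [pow_succ', Module.End.mul_apply, t.casimir_f, ih, Module.End.mul_apply]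

variable [CharZero K]

/-- A vector `e ^ k w` killed by `e` is an eigenvector of the Casimir operator with the expected
eigenvalue as soon as `e ^ (k + 1)` also kills `f w`; no weight decomposition is presupposed. -/
lemma casimir_pow_e_of_pow_succ_eq_zero (t : IsSl2Rep h e f) {k : ℕ} {w : V}
    (h₁ : (e ^ (k + 1)) w = 0) (h₂ : (e ^ (k + 1)) (f w) = 0) :
    casimir h e f ((e ^ k) w) = (k * (k + 2) : K) • (e ^ k) w := by
  have hk : (e ^ k) (h w) = -((k : K) • (e ^ k) w) := by
    have := t.pow_e_f k w
    rw [h₁, h₂, map_zero, zero_add, eq_comm, smul_eq_zero] at this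
    exact eq_neg_of_add_eq_zero_left (this.resolve_left (Nat.cast_add_one_ne_zero k))
  have he : e ((e ^ k) w) = 0 := by rw [← h₁, pow_succ']; rfl
  have hh : h ((e ^ k) w) = (k : K) • (e ^ k) w := by
    rw [t.h_pow_e, hk]; module
  rw [casimir_apply, he, hh, map_smul, hh, map_zero]
  module

omit [CharZero K] in
lemma aeval_casimir_f (t : IsSl2Rep h e f) (p : Polynomial K) (w : V) :
    Polynomial.aeval (casimir h e f) p (f w) = f (Polynomial.aeval (casimir h e f) p w) := by
  induction p using Polynomial.induction_on' generalizing w with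
  | add p q hp hq => simp [hp, hq]
  | monomial n a =>
    have : ∀ w, (casimir h e f ^ n) (f w) = f ((casimir h e f ^ n) w) := by
      induction n with
      | zero => simp
      | succ n ih => intro w; simp [pow_succ, t.casimir_f, ih]
    simp [Polynomial.aeval_monomial, this]

open Polynomial in
lemma exists_aeval_casimir_eq_zero [FiniteDimensional K V] (t : IsSl2Rep h e f) :
    ∃ N : ℕ, aeval (casimir h e f) (∏ j ∈ Finset.range N, (X - C (j * (j + 2) : K))) = 0 := by
  obtain ⟨N, hN⟩ := t.isNilpotent_e
  -- Descending induction on `k`: on the image of the product over `k < j < N` one has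
  -- `e ^ (k + 1) = 0`, so that `e ^ k` takes values in the eigenspace for `k (k + 2)`.
  have key : ∀ d k, k + d = N → ∀ w,
      (e ^ k) (aeval (casimir h e f) (∏ j ∈ Finset.Ico k N, (X - C (j * (j + 2) : K))) w) = 0 := by
    intro d
    induction d with
    | zero => rintro k rfl w; simp [show e ^ k = 0 from hN]
    | succ d ih =>
      intro k hk w
      rw [Finset.prod_eq_prod_Ico_succ_bot (by omega)]
      have h3 := t.casimir_pow_e_of_pow_succ_eq_zero (ih (k + 1) (by omega) w)
        (by rw [← t.aeval_casimir_f]; exact ih (k + 1) (by omega) _)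
      rw [map_mul (aeval (casimir h e f)), Module.End.mul_apply, map_sub, aeval_X, aeval_C,
        LinearMap.sub_apply, Module.algebraMap_end_apply, map_sub, map_smul, ← t.casimir_pow_e, h3,
        sub_self]
  refine ⟨N, LinearMap.ext fun w => ?_⟩
  have := key N 0 (zero_add N) w
  rwa [pow_zero, ← Finset.range_eq_Ico] at this

/-- On the eigenspace of the Casimir operator for `j(j + 2)`, only highest weights `≤ j` occur. -/
lemma pow_succ_e_eq_zero [FiniteDimensional K V] (t : IsSl2Rep h e f) (j : ℕ) {w : V}
    (hw : casimir h e f w = (j * (j + 2) : K) • w) : (e ^ (j + 1)) w = 0 := by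
  obtain ⟨N, hN⟩ := t.isNilpotent_e
  have H : ∀ d, (∀ w, casimir h e f w = (j * (j + 2) : K) • w → (e ^ (j + 1 + d)) w = 0) →
      ∀ w, casimir h e f w = (j * (j + 2) : K) • w → (e ^ (j + 1)) w = 0 := by
    intro d
    induction d with
    | zero => exact id
    | succ d ih =>
      refine fun hd => ih fun w hw => ?_
      have h3 := t.casimir_pow_e_of_pow_succ_eq_zero (hd w hw)
        (hd (f w) (by rw [t.casimir_f, hw, map_smul]))
      rw [t.casimir_pow_e, hw, map_smul, ← sub_eq_zero, ← sub_smul, smul_eq_zero] at h3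
      refine h3.resolve_left fun h4 => ?_
      have h5 : ((j * (j + 2) : ℕ) : K) = ((j + 1 + d) * (j + 1 + d + 2) : ℕ) := by
        simp only [Nat.add_eq] at h4
        push_cast at h4 ⊢
        exact sub_eq_zero.1 h4
      have h6 := Nat.cast_injective h5
      nlinarith
  refine H N (fun w _ => ?_) w hw
  rw [add_comm, pow_add, hN, zero_mul, LinearMap.zero_apply]

omit [CharZero K] in
open Polynomial in
lemma pow_f_pow_e (t : IsSl2Rep h e f) (j : K) (k : ℕ) {w : V}
    (hw : casimir h e f w = (j * (j + 2)) • w) :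
    (4 : K) ^ k • (f ^ k) ((e ^ k) w) =
      aeval h (∏ i ∈ Finset.range k, (C (j - 2 * i) - X) * (X + C (j + 2 + 2 * i))) w := by
  induction k generalizing w with
  | zero => simp
  | succ k ih =>
    have hg : aeval h ((C (j - 2 * k) - X) * (X + C (j + 2 + 2 * k))) w
        = ((j - 2 * k) * (j + 2 + 2 * k)) • w - (4 * k + 2 : K) • h w - h (h w) := by
      simp only [map_mul, map_add, map_sub, aeval_X, aeval_C, Module.End.mul_apply,
        LinearMap.sub_apply, LinearMap.add_apply, Module.algebraMap_end_apply, map_smul]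
      module
    rw [Finset.prod_range_succ, map_mul, Module.End.mul_apply, ← ih, hg]
    · have h1 : casimir h e f ((e ^ k) w) = (j * (j + 2)) • (e ^ k) w := by
        rw [t.casimir_pow_e, hw, map_smul]
      have h2 : (4 : K) • f (e ((e ^ k) w)) = (j * (j + 2)) • (e ^ k) w - h (h ((e ^ k) w))
          - (2 : K) • h ((e ^ k) w) := by
        rw [← h1, casimir_apply]; abel
      rw [pow_succ' e, pow_succ f, pow_succ (4 : K), mul_smul]
      simp only [Module.End.mul_apply]
      rw [← map_smul, h2, t.h_pow_e, map_add, map_smul, t.h_pow_e, t.h_pow_e]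
      simp only [map_sub, map_smul, map_add]
      module
    · rw [hg]
      simp only [map_sub, map_smul, t.casimir_h, hw]
      module

omit [CharZero K] in
open Polynomial in
/-- A vector killed by a product of distinct linear factors in `T` is a sum of eigenvectors. -/
lemma mem_iSup_eigenspace_of_aeval_prod_eq_zero (T : Module.End K V) {ι : Type*} (a : ι → K)
    (ha : Function.Injective a) (s : Finset ι) {w : V}
    (hw : aeval T (∏ i ∈ s, (X - C (a i))) w = 0) : w ∈ ⨆ i, T.eigenspace (a i) := by
  classical
  induction s using Finset.induction_on generalizing w with
  | empty => simp_all
  | insert i s hi ih =>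
    rw [Finset.prod_insert hi] at hw
    have hcop : IsCoprime (X - C (a i)) (∏ i ∈ s, (X - C (a i))) :=
      IsCoprime.prod_right fun k hk => isCoprime_X_sub_C_of_isUnit_sub
        (sub_ne_zero.2 fun hik : a i = a k => hi ((ha hik).symm ▸ hk)).isUnit
    have h1 := sup_ker_aeval_eq_ker_aeval_mul_of_coprime T hcop
    rw [← LinearMap.mem_ker, ← h1, Submodule.mem_sup] at hw
    obtain ⟨y, hy, z, hz, rfl⟩ := hw
    refine add_mem (Submodule.mem_iSup_of_mem i ?_) (ih (LinearMap.mem_ker.1 hz))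
    rw [Module.End.mem_eigenspace_iff, ← sub_eq_zero]
    simpa using hy

open Polynomial in
/-- The element `h` of an `sl₂`-triple acts on every finite-dimensional representation as a
diagonalizable operator with integral eigenvalues. -/
theorem iSup_eigenspace_h_eq_top [FiniteDimensional K V] (t : IsSl2Rep h e f) :
    ⨆ n : ℤ, h.eigenspace (n : K) = ⊤ := by
  refine eq_top_iff.2 fun w _ => ?_
  obtain ⟨N, hN⟩ := t.exists_aeval_casimir_eq_zero
  have h1 := mem_iSup_eigenspace_of_aeval_prod_eq_zero (casimir h e f)
    (fun j : ℕ => (j * (j + 2) : K)) (fun a b hab => by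
      have : a * (a + 2) = b * (b + 2) := by
        simp only at hab
        exact_mod_cast hab
      nlinarith [lt_trichotomy a b]) (Finset.range N) (w := w) (by rw [hN]; rfl)
  refine (iSup_le fun j x hx => ?_ :
    ⨆ j : ℕ, (casimir h e f).eigenspace (j * (j + 2) : K) ≤ _) h1
  rw [Module.End.mem_eigenspace_iff] at hx
  have h2 := t.pow_f_pow_e (j : K) (j + 1) hx
  rw [t.pow_succ_e_eq_zero j hx, map_zero, smul_zero] at h2
  -- The two families of factors have the roots `j, j - 2, …, -j` and `-j - 2, …, -3j - 2`.
  have h3 := mem_iSup_eigenspace_of_aeval_prod_eq_zero h (fun n : ℤ => (n : K)) Int.cast_injective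
    ((Finset.range (2 * (j + 1))).image fun i : ℕ => (j - 2 * i : ℤ)) (w := x) ?_
  · exact h3
  rw [Finset.prod_image (fun a _ b _ hab => by simpa using hab), two_mul,
    Finset.prod_range_add, ← Finset.prod_mul_distrib]
  have h4 : ∀ i ∈ Finset.range (j + 1), (C (j - 2 * i : K) - X) * (X + C (j + 2 + 2 * i : K)) =
      C (-1) *
        ((X - C (((j - 2 * i : ℤ)) : K)) * (X - C (((j - 2 * (j + 1 + i : ℕ) : ℤ)) : K))) := by
    intro i _
    push_cast
    simp only [map_sub, map_add, map_mul, map_neg, map_natCast, map_ofNat, map_one]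
    ring
  rw [Finset.prod_congr rfl h4, Finset.prod_mul_distrib, map_mul, Module.End.mul_apply,
    Finset.prod_const, ← C_pow, aeval_C, Module.algebraMap_end_apply, eq_comm, smul_eq_zero] at h2
  exact h2.resolve_left (pow_ne_zero _ (by simp))

/-- On the weight space of weight `m`, the first `m` powers of the lowering operator are
injective. -/
theorem pow_f_apply_ne_zero [FiniteDimensional K V] (t : IsSl2Rep h e f) {m k : ℕ} (hk : k ≤ m)
    {w : V} (hw : h w = (m : K) • w) (h0 : w ≠ 0) : (f ^ k) w ≠ 0 := by
  induction k generalizing w with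
  | zero => simpa
  | succ k ih =>
    intro hz
    -- `4 e f ^ (k + 1) w = f ^ k (C - c) w`, where `c + 1 = (m - 2k - 1) ^ 2`.
    set c : K := (m - 2 * k) * (m - 2 * k - 2) with hc
    have h1 : (f ^ k) (casimir h e f w - c • w) = 0 := by
      have hx : h ((f ^ k) w) = (m - 2 * k : K) • (f ^ k) w := by
        rw [t.h_pow_f, hw, map_smul]; module
      have h2 : f ((f ^ k) w) = 0 := by rw [← hz, pow_succ']; rfl
      have h3 : f (e ((f ^ k) w)) = -h ((f ^ k) w) := by
        have := t.e_f ((f ^ k) w)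
        rw [h2, map_zero] at this
        exact eq_neg_of_add_eq_zero_left this.symm
      rw [map_sub, ← t.casimir_pow_f, casimir_apply, h3, map_smul, hx, map_smul, hx, hc]
      module
    have h2 : casimir h e f w = c • w := by
      by_contra hne
      refine ih (by omega) ?_ (sub_ne_zero.2 hne) h1
      rw [map_sub, ← t.casimir_h, hw]
      simp only [map_smul, hw]
      module
    -- All the vectors `e ^ i w` are then nonzero.
    obtain ⟨N, hN⟩ := t.isNilpotent_e
    have h3 : ∀ i, (e ^ i) w ≠ 0 := by
      intro i
      induction i with
      | zero => simpa
      | succ i ihi =>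
        intro hz'
        have h4 : e ((e ^ i) w) = 0 := by rw [← hz', pow_succ']; rfl
        have h5 : h ((e ^ i) w) = (m + 2 * i : K) • (e ^ i) w := by
          rw [t.h_pow_e, hw, map_smul]; module
        have h6 : casimir h e f ((e ^ i) w) = c • (e ^ i) w := by
          rw [t.casimir_pow_e, h2, map_smul]
        rw [casimir_apply, h4, h5, map_smul, h5, map_zero, smul_zero, zero_add, smul_smul,
          smul_smul, ← add_smul, ← sub_eq_zero, ← sub_smul, smul_eq_zero] at h6
        have h7 := h6.resolve_right ihi
        have h8 : (((m + 2 * i + 1) ^ 2 - (m - 2 * k - 1) ^ 2 : ℤ) : K) = 0 := by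
          push_cast
          rw [← h7, hc]
          ring
        have h9 := Int.cast_eq_zero.1 h8
        have : (k : ℤ) + 1 ≤ m := by exact_mod_cast hk
        have h10 : (0 : ℤ) < (i + k + 1) * (m + i - k) := mul_pos (by omega) (by omega)
        linarith
    exact h3 N (by rw [hN]; rfl)

end IsSl2Rep
end Sl2

/-! ### Weights of representations of `gl₃` -/

section Weights

variable {𝕜 W : Type*} [RCLike 𝕜] [AddCommGroup W] [Module ℝ W]

/-- The real linear map `R` is a representation of the real Lie algebra `gl₃(𝕜)`. -/
def IsGlRep (R : Matrix (Fin 3) (Fin 3) 𝕜 →ₗ[ℝ] Module.End ℝ W) : Prop :=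
  ∀ x y w, R (x * y - y * x) w = R x (R y w) - R y (R x w)

/-- The action of the matrix with the single nonzero entry `z` in position `(i, j)`. -/
noncomputable def elemAct (R : Matrix (Fin 3) (Fin 3) 𝕜 →ₗ[ℝ] Module.End ℝ W) (i j : Fin 3) :
    𝕜 →ₗ[ℝ] Module.End ℝ W :=
  R ∘ₗ Matrix.singleLinearMap ℝ i j

variable {R : Matrix (Fin 3) (Fin 3) 𝕜 →ₗ[ℝ] Module.End ℝ W}

local notation "X" => elemAct R

lemma elemAct_apply (i j : Fin 3) (z : 𝕜) : X i j z = R (Matrix.single i j z) := rfl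

lemma IsGlRep.comm (hR : IsGlRep R) (i j k l : Fin 3) (z w : 𝕜) (u : W) :
    X i j z (X k l w u) = X k l w (X i j z u) + (if j = k then X i l (z * w) u else 0)
      - (if l = i then X k j (w * z) u else 0) := by
  have h := hR (Matrix.single i j z) (Matrix.single k l w) u
  rw [eq_comm, sub_eq_iff_eq_add'] at h
  simp only [elemAct_apply]
  rw [h, map_sub, LinearMap.sub_apply, add_sub_assoc]
  congr 2
  · split_ifs with hjk
    · subst hjk; simp
    · rw [Matrix.single_mul_single_of_ne _ _ _ _ hjk]; simp
  · split_ifs with hjk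
    · subst hjk; simp
    · rw [Matrix.single_mul_single_of_ne _ _ _ _ hjk]; simp

lemma IsGlRep.isSl2Rep (hR : IsGlRep R) {i j : Fin 3} (hij : i ≠ j) :
    IsSl2Rep (X i i 1 - X j j 1) (X i j 1) (X j i 1) where
  h_e w := by
    simp only [LinearMap.sub_apply, hR.comm i i i j, hR.comm j j i j, if_neg hij.symm,
      if_true, mul_one, map_sub]
    module
  h_f w := by
    simp only [LinearMap.sub_apply, hR.comm i i j i, hR.comm j j j i, if_neg hij,
      if_true, mul_one, map_sub]
    module
  e_f w := by
    simp only [LinearMap.sub_apply, hR.comm i j j i, if_true, mul_one]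
    abel

variable (R) in
/-- The space of vectors on which `E₀₀ - E₁₁` acts by `a` and `E₁₁ - E₂₂` acts by `b`. The
coordinates of the `i`-th weight of the standard representation are `![1, -1, 0] i` and
`![0, 1, -1] i`. -/
noncomputable def wt (a b : ℤ) : Submodule ℝ W :=
  Module.End.eigenspace (X 0 0 1 - X 1 1 1) (a : ℝ) ⊓
    Module.End.eigenspace (X 1 1 1 - X 2 2 1) (b : ℝ)

lemma mem_wt {a b : ℤ} {w : W} : w ∈ wt R a b ↔
    X 0 0 1 w - X 1 1 1 w = (a : ℝ) • w ∧ X 1 1 1 w - X 2 2 1 w = (b : ℝ) • w := by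
  simp [wt, Submodule.mem_inf]

variable (R) in
/-- A weight of `R` is a pair of integers with nonzero weight space. -/
def IsWeight (a b : ℤ) : Prop := ∃ w ∈ wt R a b, w ≠ 0

lemma IsGlRep.elemAct_mem_wt (hR : IsGlRep R) (i j : Fin 3) (z : 𝕜) {a b : ℤ} {w : W}
    (hw : w ∈ wt R a b) : X i j z w ∈
      wt R (a + (![1, -1, 0] i - ![1, -1, 0] j)) (b + (![0, 1, -1] i - ![0, 1, -1] j)) := by
  rw [mem_wt] at hw ⊢
  have h1 := congrArg (X i j z) hw.1
  have h2 := congrArg (X i j z) hw.2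
  rw [map_sub, map_smul] at h1 h2
  simp only [hR.comm _ _ i j, mul_one, one_mul]
  push_cast
  rw [add_smul, add_smul, ← h1, ← h2]
  constructor <;> fin_cases i <;> fin_cases j <;> simp <;> module

lemma IsGlRep.elemAct_pow_mem_wt (hR : IsGlRep R) (i j : Fin 3) (z : 𝕜) {a b : ℤ} {w : W}
    (hw : w ∈ wt R a b) (k : ℕ) : ((X i j z) ^ k) w ∈
      wt R (a + k * (![1, -1, 0] i - ![1, -1, 0] j)) (b + k * (![0, 1, -1] i - ![0, 1, -1] j)) := by
  induction k with
  | zero => simpa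
  | succ k ih =>
    rw [pow_succ', Module.End.mul_apply]
    convert hR.elemAct_mem_wt i j z ih using 1
    push_cast
    congr 1 <;> ring

lemma eq_zero_of_mem_wt_of_mem_wt {a b a' b' : ℤ} {w : W} (h : w ∈ wt R a b)
    (h' : w ∈ wt R a' b') (hne : (a, b) ≠ (a', b')) : w = 0 := by
  rw [mem_wt] at h h'
  by_contra hw
  have h1 := smul_left_injective ℝ hw (h.1.symm.trans h'.1)
  have h2 := smul_left_injective ℝ hw (h.2.symm.trans h'.2)
  exact hne (Prod.ext (Int.cast_injective h1) (Int.cast_injective h2))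

variable [FiniteDimensional ℝ W]

theorem IsGlRep.iSup_wt_eq_top (hR : IsGlRep R) : ⨆ a, ⨆ b, wt R a b = ⊤ := by
  rw [← (hR.isSl2Rep (i := 0) (j := 1) (by decide)).iSup_eigenspace_h_eq_top]
  refine le_antisymm (iSup_mono fun a => iSup_le fun b => inf_le_left) (iSup_le fun a => ?_)
  refine le_trans ?_ (le_iSup _ a)
  have h2 := (hR.isSl2Rep (i := 1) (j := 2) (by decide)).iSup_eigenspace_h_eq_top
  have h3 : ∀ x ∈ Module.End.eigenspace (X 0 0 1 - X 1 1 1) (a : ℝ),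
      (X 1 1 1 - X 2 2 1) x ∈ Module.End.eigenspace (X 0 0 1 - X 1 1 1) (a : ℝ) := by
    intro x hx
    rw [Module.End.mem_eigenspace_iff] at hx ⊢
    rw [← map_smul, ← hx]
    simp only [LinearMap.sub_apply, map_sub]
    rw [hR.comm 1 1 0 0, hR.comm 2 2 0 0, hR.comm 1 1 1 1, hR.comm 2 2 1 1]
    simp
    abel
  intro x hx
  have h4 := Submodule.inf_iSup_genEigenspace h3 1
  have h5 : ⨆ μ : ℝ, (X 1 1 1 - X 2 2 1).genEigenspace μ 1 = ⊤ :=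
    eq_top_iff.2 (h2 ▸ iSup_le fun n => le_iSup
      (fun μ : ℝ => (X 1 1 1 - X 2 2 1).genEigenspace μ 1) (n : ℝ))
  rw [h5, inf_top_eq] at h4
  rw [h4] at hx
  refine (iSup_le fun μ => ?_ : _ ≤ ⨆ b, wt R a b) hx
  by_cases hμ : ∃ n : ℤ, (n : ℝ) = μ
  · obtain ⟨n, rfl⟩ := hμ
    exact le_iSup (wt R a) n
  · have h6 := Module.End.eigenspaces_iSupIndep (X 1 1 1 - X 2 2 1) μ
    have h7 : ⨆ ν, ⨆ (_ : ν ≠ μ), Module.End.eigenspace (X 1 1 1 - X 2 2 1) ν = ⊤ :=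
      eq_top_iff.2 (h2 ▸ iSup_le fun n => le_iSup₂_of_le (n : ℝ)
        (fun h => hμ ⟨n, h⟩) le_rfl)
    rw [h7, disjoint_top] at h6
    exact inf_le_right.trans (h6.le.trans bot_le)

/-- A subspace containing all the weight spaces is everything. -/
lemma IsGlRep.induction_wt (hR : IsGlRep R) {N : Submodule ℝ W}
    (h : ∀ a b, wt R a b ≤ N) (w : W) : w ∈ N := by
  have : (⊤ : Submodule ℝ W) ≤ N := hR.iSup_wt_eq_top ▸ iSup₂_le h
  exact this trivial

omit [FiniteDimensional ℝ W] in
lemma mem_eigenspaces_of_mem_wt {a b : ℤ} {w : W} (hw : w ∈ wt R a b) :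
    (X 0 0 1 - X 1 1 1) w = (a : ℝ) • w ∧ (X 1 1 1 - X 2 2 1) w = (b : ℝ) • w :=
  mem_wt.1 hw

variable (R) in
lemma finite_setOf_isWeight : {p : ℤ × ℤ | IsWeight R p.1 p.2}.Finite := by
  refine Set.Finite.subset (((X 0 0 1 - X 1 1 1).finite_hasEigenvalue.preimage
    (f := fun n : ℤ => (n : ℝ)) Int.cast_injective.injOn).prod
    ((X 1 1 1 - X 2 2 1).finite_hasEigenvalue.preimage
    (f := fun n : ℤ => (n : ℝ)) Int.cast_injective.injOn)) ?_
  rintro ⟨a, b⟩ ⟨w, hw, h0⟩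
  exact ⟨Module.End.hasEigenvalue_of_hasEigenvector ⟨hw.1, h0⟩,
    Module.End.hasEigenvalue_of_hasEigenvector ⟨hw.2, h0⟩⟩

lemma IsGlRep.isWeight_reflect₀₁ (hR : IsGlRep R) {a b : ℤ} (h : IsWeight R a b) :
    IsWeight R (-a) (a + b) := by
  obtain ⟨w, hw, h0⟩ := h
  rcases le_total 0 a with ha | ha
  · obtain ⟨m, rfl⟩ := Int.eq_ofNat_of_zero_le ha
    refine ⟨((X 1 0 1) ^ m) w, ?_, (hR.isSl2Rep (i := 0) (j := 1) (by decide)).pow_f_apply_ne_zero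
      le_rfl (by simpa using hw.1) h0⟩
    convert hR.elemAct_pow_mem_wt 1 0 1 hw m using 1
    simp; congr 1 <;> ring
  · obtain ⟨m, hm⟩ := Int.eq_ofNat_of_zero_le (neg_nonneg.2 ha)
    obtain rfl : a = -m := by omega
    refine ⟨((X 0 1 1) ^ m) w, ?_, (hR.isSl2Rep (i := 1) (j := 0) (by decide)).pow_f_apply_ne_zero
      le_rfl ?_ h0⟩
    · convert hR.elemAct_pow_mem_wt 0 1 1 hw m using 1
      simp; congr 1 <;> ring
    · rw [← neg_sub, LinearMap.neg_apply, (mem_eigenspaces_of_mem_wt hw).1]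
      simp

lemma IsGlRep.isWeight_reflect₁₂ (hR : IsGlRep R) {a b : ℤ} (h : IsWeight R a b) :
    IsWeight R (a + b) (-b) := by
  obtain ⟨w, hw, h0⟩ := h
  rcases le_total 0 b with ha | ha
  · obtain ⟨m, rfl⟩ := Int.eq_ofNat_of_zero_le ha
    refine ⟨((X 2 1 1) ^ m) w, ?_, (hR.isSl2Rep (i := 1) (j := 2) (by decide)).pow_f_apply_ne_zero
      le_rfl (by simpa using hw.2) h0⟩
    convert hR.elemAct_pow_mem_wt 2 1 1 hw m using 1
    simp; congr 1; ring
  · obtain ⟨m, hm⟩ := Int.eq_ofNat_of_zero_le (neg_nonneg.2 ha)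
    obtain rfl : b = -m := by omega
    refine ⟨((X 1 2 1) ^ m) w, ?_, (hR.isSl2Rep (i := 2) (j := 1) (by decide)).pow_f_apply_ne_zero
      le_rfl ?_ h0⟩
    · convert hR.elemAct_pow_mem_wt 1 2 1 hw m using 1
      simp; congr 1; ring
    · rw [← neg_sub, LinearMap.neg_apply, (mem_eigenspaces_of_mem_wt hw).2]
      simp

/-- Every orbit of weights under the Weyl group contains a dominant weight; the quadratic form
`a² + ab + b²` is invariant under the Weyl group. -/
lemma IsGlRep.exists_dominant (hR : IsGlRep R) {a b : ℤ} (h : IsWeight R a b) :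
    ∃ a' b', 0 ≤ a' ∧ 0 ≤ b' ∧ IsWeight R a' b' ∧
      a' ^ 2 + a' * b' + b' ^ 2 = a ^ 2 + a * b + b ^ 2 := by
  have h1 := hR.isWeight_reflect₀₁ h
  have h2 := hR.isWeight_reflect₁₂ h
  have h12 := hR.isWeight_reflect₁₂ h1
  have h21 := hR.isWeight_reflect₀₁ h2
  have h121 := hR.isWeight_reflect₀₁ h12
  by_cases c0 : 0 ≤ a ∧ 0 ≤ b
  · exact ⟨_, _, c0.1, c0.2, h, rfl⟩
  by_cases c1 : 0 ≤ -a ∧ 0 ≤ a + b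
  · exact ⟨_, _, c1.1, c1.2, h1, by ring⟩
  by_cases c2 : 0 ≤ a + b ∧ 0 ≤ -b
  · exact ⟨_, _, c2.1, c2.2, h2, by ring⟩
  by_cases c3 : 0 ≤ -a + (a + b) ∧ 0 ≤ -(a + b)
  · exact ⟨_, _, c3.1, c3.2, h12, by ring⟩
  by_cases c4 : 0 ≤ -(a + b) ∧ 0 ≤ a + b + -b
  · exact ⟨_, _, c4.1, c4.2, h21, by ring⟩
  exact ⟨_, _, by omega, by omega, h121, by ring⟩

end Weights

/-! ### Weights of representations carrying an invariant product -/

section Cup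

variable {𝕜 W : Type*} [RCLike 𝕜] [AddCommGroup W] [Module ℝ W]

/-- The representation `R` twisted by the automorphism `x ↦ -xᵀ`. -/
noncomputable def negTransposeRep (R : Matrix (Fin 3) (Fin 3) 𝕜 →ₗ[ℝ] Module.End ℝ W) :
    Matrix (Fin 3) (Fin 3) 𝕜 →ₗ[ℝ] Module.End ℝ W :=
  -(R ∘ₗ (Matrix.transposeLinearEquiv (Fin 3) (Fin 3) ℝ 𝕜).toLinearMap)

/-- The product `cup` is symmetric, invariant under `R`, and does not vanish identically on any
plane. -/
structure IsCup (R : Matrix (Fin 3) (Fin 3) 𝕜 →ₗ[ℝ] Module.End ℝ W)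
    (cup : W →ₗ[ℝ] W →ₗ[ℝ] Module.Dual ℝ W) : Prop where
  symm : ∀ u v, cup u v = cup v u
  invariant : ∀ x u v w, cup (R x u) v w + cup u (R x v) w + cup u v (R x w) = 0
  plane : ∀ u v, LinearIndependent ℝ ![u, v] → cup u u ≠ 0 ∨ cup u v ≠ 0 ∨ cup v v ≠ 0

/-- The weights of `R` are among the weights of `Sym₂(E*) ⊕ E ⊕ T`, and the highest weight of
`Sym₂(E*)` occurs with multiplicity one. -/
structure HasModelWeights (R : Matrix (Fin 3) (Fin 3) 𝕜 →ₗ[ℝ] Module.End ℝ W) : Prop where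
  mem : ∀ a b, IsWeight R a b → (a, b) ∈
    ({(0, 0), (1, 0), (-1, 1), (0, -1), (-2, 0), (2, -2), (0, 2)} : Finset (ℤ × ℤ))
  exists_span : ∃ v ∈ wt R 0 2, v ≠ 0 ∧ ∀ w ∈ wt R 0 2, ∃ r : ℝ, w = r • v

variable {R : Matrix (Fin 3) (Fin 3) 𝕜 →ₗ[ℝ] Module.End ℝ W}
  {cup : W →ₗ[ℝ] W →ₗ[ℝ] Module.Dual ℝ W}

lemma negTransposeRep_apply (x : Matrix (Fin 3) (Fin 3) 𝕜) (w : W) :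
    negTransposeRep R x w = -R xᵀ w := rfl

lemma elemAct_negTransposeRep (i j : Fin 3) (z : 𝕜) (w : W) :
    elemAct (negTransposeRep R) i j z w = -elemAct R j i z w := by
  simp [elemAct_apply, negTransposeRep_apply]

lemma IsGlRep.negTranspose (hR : IsGlRep R) : IsGlRep (negTransposeRep R) := by
  intro x y w
  have := hR xᵀ yᵀ w
  simp only [negTransposeRep_apply, transpose_sub, transpose_mul, map_neg, neg_neg, ← this]
  rw [← LinearMap.neg_apply, ← map_neg, neg_sub]

lemma IsCup.negTranspose (hc : IsCup R cup) : IsCup (negTransposeRep R) cup where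
  symm := hc.symm
  invariant x u v w := by
    have := hc.invariant xᵀ u v w
    simp only [negTransposeRep_apply, map_neg, LinearMap.neg_apply]
    linarith
  plane := hc.plane

lemma IsWeight.negTranspose {a b : ℤ} (h : IsWeight R a b) :
    IsWeight (negTransposeRep R) (-a) (-b) := by
  obtain ⟨w, hw, h0⟩ := h
  refine ⟨w, ?_, h0⟩
  rw [mem_wt] at hw ⊢
  simp only [elemAct_negTransposeRep]
  push_cast
  rw [neg_smul, neg_smul, ← hw.1, ← hw.2]
  constructor <;> abel

lemma linearIndependent_of_mem_wt {a b a' b' : ℤ} {u v : W} (hu : u ∈ wt R a b)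
    (hv : v ∈ wt R a' b') (hu0 : u ≠ 0) (hv0 : v ≠ 0) (hne : (a, b) ≠ (a', b')) :
    LinearIndependent ℝ ![u, v] := by
  rw [LinearIndependent.pair_iff]
  intro s t hst
  have h1 : s • u = 0 := by
    refine eq_zero_of_mem_wt_of_mem_wt (Submodule.smul_mem _ s hu) ?_ hne
    rw [eq_neg_of_add_eq_zero_left hst]
    exact neg_mem (Submodule.smul_mem _ t hv)
  rw [h1, zero_add] at hst
  exact ⟨(smul_eq_zero.1 h1).resolve_right hu0, (smul_eq_zero.1 hst).resolve_right hv0⟩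

lemma IsCup.invariant_elemAct (hc : IsCup R cup) (i j : Fin 3) (z : 𝕜) (u v w : W) :
    cup (elemAct R i j z u) v w + cup u (elemAct R i j z v) w + cup u v (elemAct R i j z w) = 0 :=
  hc.invariant _ u v w

lemma IsCup.eq_zero_of_mem_wt (hc : IsCup R cup) {a b a' b' a'' b'' : ℤ} {u v w : W}
    (hu : u ∈ wt R a b) (hv : v ∈ wt R a' b') (hw : w ∈ wt R a'' b'')
    (hne : (a'', b'') ≠ (-a - a', -b - b')) : cup u v w = 0 := by
  rw [mem_wt] at hu hv hw
  by_contra h0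
  have key : ∀ i j : Fin 3, ∀ r s t : ℝ, elemAct R i i 1 u - elemAct R j j 1 u = r • u →
      elemAct R i i 1 v - elemAct R j j 1 v = s • v →
      elemAct R i i 1 w - elemAct R j j 1 w = t • w → r + s + t = 0 := by
    intro i j r s t h1 h2 h3
    have e1 := hc.invariant_elemAct i i 1 u v w
    have e2 := hc.invariant_elemAct j j 1 u v w
    have f1 := congrArg (fun x => cup x v w) h1
    have f2 := congrArg (fun x => cup u x w) h2
    have f3 := congrArg (fun x => cup u v x) h3
    simp only [map_sub, map_smul, LinearMap.sub_apply, LinearMap.smul_apply, smul_eq_mul]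
      at f1 f2 f3
    refine (mul_eq_zero.1 (?_ : (r + s + t) * cup u v w = 0)).resolve_right h0
    linarith
  have k1 := key _ _ _ _ _ hu.1 hv.1 hw.1
  have k2 := key _ _ _ _ _ hu.2 hv.2 hw.2
  refine hne (Prod.ext ?_ ?_)
  · have : ((a + a' + a'' : ℤ) : ℝ) = 0 := by push_cast; exact k1
    have := Int.cast_eq_zero.1 this
    simp only; omega
  · have : ((b + b' + b'' : ℤ) : ℝ) = 0 := by push_cast; exact k2
    have := Int.cast_eq_zero.1 this
    simp only; omega

variable [FiniteDimensional ℝ W]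

/-- The product of vectors of weights `λ` and `μ` has weight `λ + μ`, so it vanishes unless
`-λ - μ` is a weight. -/
lemma IsCup.isWeight_of_ne_zero (hR : IsGlRep R) (hc : IsCup R cup) {a b a' b' : ℤ} {u v : W}
    (hu : u ∈ wt R a b) (hv : v ∈ wt R a' b') (h : cup u v ≠ 0) :
    IsWeight R (-a - a') (-b - b') := by
  by_contra hn
  refine h (LinearMap.ext fun w => ?_)
  refine hR.induction_wt (N := LinearMap.ker (cup u v)) (fun a'' b'' w hw => ?_) w
  rw [LinearMap.mem_ker]
  by_cases hw0 : w = 0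
  · rw [hw0, map_zero]
  · refine hc.eq_zero_of_mem_wt hu hv hw fun heq => hn ?_
    rw [Prod.mk.injEq] at heq
    exact ⟨w, heq.1 ▸ heq.2 ▸ hw, hw0⟩

lemma IsCup.isWeight_of_linearIndependent (hR : IsGlRep R) (hc : IsCup R cup) {a b a' b' : ℤ}
    {u v : W} (hu : u ∈ wt R a b) (hv : v ∈ wt R a' b') (h : LinearIndependent ℝ ![u, v]) :
    IsWeight R (-a - a) (-b - b) ∨ IsWeight R (-a - a') (-b - b') ∨
      IsWeight R (-a' - a') (-b' - b') :=
  (hc.plane u v h).imp (hc.isWeight_of_ne_zero hR hu hu)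
    (Or.imp (hc.isWeight_of_ne_zero hR hu hv) (hc.isWeight_of_ne_zero hR hv hv))

lemma IsCup.isWeight_of_isWeight (hR : IsGlRep R) (hc : IsCup R cup) {a b a' b' : ℤ}
    (h : IsWeight R a b) (h' : IsWeight R a' b') (hne : (a, b) ≠ (a', b')) :
    IsWeight R (-a - a) (-b - b) ∨ IsWeight R (-a - a') (-b - b') ∨
      IsWeight R (-a' - a') (-b' - b') := by
  obtain ⟨u, hu, hu0⟩ := h
  obtain ⟨v, hv, hv0⟩ := h'
  exact hc.isWeight_of_linearIndependent hR hu hv (linearIndependent_of_mem_wt hu hv hu0 hv0 hne)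

/-- A representation in which `E₀₁` acts nontrivially has a nonzero weight; hence it has a nonzero
dominant weight of maximal norm. -/
lemma IsGlRep.exists_maximal_weight (hR : IsGlRep R) (h01 : elemAct R 0 1 1 ≠ 0) :
    ∃ a b, 0 ≤ a ∧ 0 ≤ b ∧ 0 < a + b ∧ IsWeight R a b ∧ ∀ a' b', IsWeight R a' b' →
      a' ^ 2 + a' * b' + b' ^ 2 ≤ a ^ 2 + a * b + b ^ 2 := by
  have hne : ∃ a b, IsWeight R a b ∧ 0 < a ^ 2 + a * b + b ^ 2 := by
    by_contra! hcon
    have hzero : ∀ a b, IsWeight R a b → (a, b) = ((0 : ℤ), (0 : ℤ)) := by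
      intro a b h
      have h1 := hcon a b h
      have hb : b = 0 := by nlinarith [sq_nonneg (2 * a + b), sq_nonneg b]
      have ha : a = 0 := by subst hb; nlinarith
      rw [ha, hb]
    refine h01 (LinearMap.ext fun w => ?_)
    refine hR.induction_wt (N := LinearMap.ker (elemAct R 0 1 1)) (fun a b w hw => ?_) w
    rw [LinearMap.mem_ker]
    by_contra h0
    have h1 := hzero _ _ ⟨_, hR.elemAct_mem_wt 0 1 1 hw, h0⟩
    have h2 := hzero _ _ ⟨w, hw, fun hw0 => h0 (by rw [hw0, map_zero])⟩
    simp only [Prod.mk.injEq] at h1 h2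
    simp [h2.1, h2.2] at h1
  obtain ⟨a₀, b₀, h₀, hpos⟩ := hne
  obtain ⟨⟨a, b⟩, hab, hmax⟩ := Set.exists_max_image _
    (fun p : ℤ × ℤ => p.1 ^ 2 + p.1 * p.2 + p.2 ^ 2) (finite_setOf_isWeight R) ⟨(a₀, b₀), h₀⟩
  obtain ⟨a', b', ha', hb', h', hQ⟩ := hR.exists_dominant hab
  refine ⟨a', b', ha', hb', ?_, h', fun x y hxy => hQ ▸ hmax (x, y) hxy⟩
  have h1 := hmax (a₀, b₀) h₀
  simp only at h1
  rw [← hQ] at h1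
  by_contra hle
  obtain rfl : a' = 0 := by omega
  obtain rfl : b' = 0 := by omega
  linarith

omit [FiniteDimensional ℝ W] in
lemma negTransposeRep_negTransposeRep : negTransposeRep (negTransposeRep R) = R := by
  ext x w
  simp [negTransposeRep_apply]

omit [FiniteDimensional ℝ W] in
lemma IsWeight.of_negTranspose {a b : ℤ} (h : IsWeight (negTransposeRep R) a b) :
    IsWeight R (-a) (-b) := by
  simpa only [negTransposeRep_negTransposeRep] using h.negTranspose

/-- The extremal weights cannot be those of `E*`. Let `v` be a vector of weight `-ε₂`, so that
`E₂₁ v` has weight `-ε₁`; only vectors `w` of weight `-ε₀` can pair nontrivially with the product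
of the two. As `E₂₁ w = 0`, the invariance of the trilinear form at `(v, v, w)` shows that they do
not either, and the product vanishes on the plane spanned by `v` and `E₂₁ v`. -/
lemma IsCup.maximal_weight_ne_one (hR : IsGlRep R) (hc : IsCup R cup) (h : IsWeight R 0 1)
    (hmax : ∀ a b, IsWeight R a b → a ^ 2 + a * b + b ^ 2 ≤ 1) : False := by
  obtain ⟨v, hv, hv0⟩ := h
  have hfv : elemAct R 2 1 1 v ∈ wt R 1 (-1) := by simpa using hR.elemAct_mem_wt 2 1 1 hv
  have hfv0 : elemAct R 2 1 1 v ≠ 0 := by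
    have := (hR.isSl2Rep (i := 1) (j := 2) (by decide)).pow_f_apply_ne_zero (m := 1) le_rfl
      (by simpa using hv.2) hv0
    rwa [pow_one] at this
  have hzero : cup v (elemAct R 2 1 1 v) = 0 := by
    by_contra hne
    refine hne (LinearMap.ext fun w => ?_)
    refine hR.induction_wt (N := LinearMap.ker (cup v (elemAct R 2 1 1 v)))
      (fun a b w hw => ?_) w
    rw [LinearMap.mem_ker]
    by_cases hab : (a, b) = (-0 - 1, -1 - -1)
    · rw [Prod.mk.injEq] at hab
      obtain ⟨rfl, rfl⟩ := hab
      have hfw : elemAct R 2 1 1 w = 0 := by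
        by_contra hfw0
        have := hmax _ _ ⟨_, hR.elemAct_mem_wt 2 1 1 hw, hfw0⟩
        simp at this
      have h1 := hc.invariant_elemAct 2 1 1 v v w
      rw [hfw, map_zero, hc.symm (elemAct R 2 1 1 v) v] at h1
      linarith
    · exact hc.eq_zero_of_mem_wt hv hfv hw hab
  rcases hc.plane _ _ (linearIndependent_of_mem_wt hv hfv hv0 hfv0 (by decide)) with h1 | h1 | h1
  · have := hmax _ _ (hc.isWeight_of_ne_zero hR hv hv h1)
    norm_num at this
  · exact h1 hzero
  · have := hmax _ _ (hc.isWeight_of_ne_zero hR hfv hfv h1)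
    norm_num at this

/-- An extremal weight `λ = (0, n)` comes with the weight `μ = (1, n - 2)`, and one of `-2λ`,
`-λ - μ`, `-2μ` has to be a weight; for `n > 2` all three are longer than `λ`. -/
lemma IsCup.maximal_weight_eq_two (hR : IsGlRep R) (hc : IsCup R cup) {n : ℤ} (hn : 0 < n)
    (h : IsWeight R 0 n)
    (hmax : ∀ a b, IsWeight R a b → a ^ 2 + a * b + b ^ 2 ≤ n ^ 2) : n = 2 := by
  obtain ⟨v, hv, hv0⟩ := h
  have hfv := hR.elemAct_mem_wt 2 1 1 hv
  have hfv0 : elemAct R 2 1 1 v ≠ 0 := by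
    obtain ⟨m, rfl⟩ := Int.eq_ofNat_of_zero_le hn.le
    have := (hR.isSl2Rep (i := 1) (j := 2) (by decide)).pow_f_apply_ne_zero (m := m) (k := 1)
      (by omega) (by simpa using hv.2) hv0
    rwa [pow_one] at this
  simp only [cons_val, zero_add, sub_neg_eq_add, Int.reduceSub] at hfv
  rcases hc.isWeight_of_linearIndependent hR hv hfv
    (linearIndependent_of_mem_wt hv hfv hv0 hfv0 (by simp)) with h1 | h1 | h1
  · have := hmax _ _ h1
    nlinarith
  · have := hmax _ _ h1
    obtain rfl : n = 1 := by nlinarith [sq_nonneg (n - 1)]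
    exact (hc.maximal_weight_ne_one hR ⟨v, hv, hv0⟩ (by simpa using hmax)).elim
  · have := hmax _ _ h1
    nlinarith [sq_nonneg (n - 2)]

lemma IsCup.hasModelWeights_of_maximal_weight (hR : IsGlRep R) (hc : IsCup R cup)
    (h : IsWeight R 0 2) (hmax : ∀ a b, IsWeight R a b → a ^ 2 + a * b + b ^ 2 ≤ 4) :
    HasModelWeights R := by
  have h₂ : IsWeight R 2 (-2) := by simpa using hR.isWeight_reflect₁₂ h
  have h₁ : IsWeight R (-2) 0 := by simpa using hR.isWeight_reflect₀₁ h₂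
  have hext : ∀ p ∈ ({(-2, 0), (2, -2), (0, 2)} : Finset (ℤ × ℤ)), IsWeight R p.1 p.2 := by
    simp [h, h₁, h₂]
  have hbox : ∀ a b, IsWeight R a b → a ∈ Finset.Icc (-2) 2 ∧ b ∈ Finset.Icc (-2) 2 := by
    intro a b hab
    have hQ := hmax a b hab
    rw [Finset.mem_Icc, Finset.mem_Icc]
    refine ⟨⟨?_, ?_⟩, ?_, ?_⟩ <;> nlinarith [sq_nonneg (2 * b + a), sq_nonneg (2 * a + b)]
  -- If `S` contains all weights, then it contains one of `-2λ`, `-λ - μ`, `-2μ` for each extremal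
  -- weight `λ` and each other weight `μ`. This is used twice, the second time with a smaller `S`.
  have step : ∀ S : ℤ → ℤ → Prop, (∀ a b, IsWeight R a b → S a b) →
      ∀ a b, IsWeight R a b → ∀ p ∈ ({(-2, 0), (2, -2), (0, 2)} : Finset (ℤ × ℤ)), p ≠ (a, b) →
        S (-p.1 - p.1) (-p.2 - p.2) ∨ S (-p.1 - a) (-p.2 - b) ∨ S (-a - a) (-b - b) :=
    fun S hS a b hab p hp hne =>
      (hc.isWeight_of_isWeight hR (hext p hp) hab hne).imp (hS _ _) (Or.imp (hS _ _) (hS _ _))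
  have hS : ∀ a b, IsWeight R a b → (a, b) ∈ ({(0, 0), (1, 0), (-1, 1), (0, -1), (-1, 0), (1, -1),
      (0, 1), (-2, 0), (2, -2), (0, 2)} : Finset (ℤ × ℤ)) := by
    intro a b hab
    have h1 := step _ hmax a b hab
    have h2 := hmax a b hab
    obtain ⟨ha, hb⟩ := hbox a b hab
    clear hab
    revert h2; revert h1; revert hb; revert b; revert ha; revert a
    decide
  have hS' : ∀ a b, IsWeight R a b → (a, b) ∈
      ({(0, 0), (1, 0), (-1, 1), (0, -1), (-2, 0), (2, -2), (0, 2)} : Finset (ℤ × ℤ)) := by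
    intro a b hab
    have h1 := step _ hS a b hab
    obtain ⟨ha, hb⟩ := hbox a b hab
    have h2 := hS a b hab
    clear hab
    revert h2; revert h1; revert hb; revert b; revert ha; revert a
    decide
  refine ⟨hS', ?_⟩
  · obtain ⟨v, hv, hv0⟩ := h
    refine ⟨v, hv, hv0, fun w hw => ?_⟩
    by_contra! hcon
    have hli : LinearIndependent ℝ ![v, w] := by
      rw [LinearIndependent.pair_iff' hv0]
      exact fun r hr => hcon r hr.symm
    rcases hc.isWeight_of_linearIndependent hR hv hw hli with h1 | h1 | h1 <;>
    · have := hmax _ _ h1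
      norm_num at this

/-- After twisting by `x ↦ -xᵀ` if necessary, a representation of `sl₃` that carries a product not
vanishing identically on any plane has the weights of `Sym₂(E*) ⊕ E ⊕ T`. -/
theorem IsCup.hasModelWeights (hR : IsGlRep R) (hc : IsCup R cup) (h01 : elemAct R 0 1 1 ≠ 0) :
    HasModelWeights R ∨ HasModelWeights (negTransposeRep R) := by
  obtain ⟨a, b, ha, hb, hab, h, hmax⟩ := hR.exists_maximal_weight h01
  rcases ha.eq_or_lt with rfl | ha
  · left
    have hb' : 0 < b := by omega
    have hmax' : ∀ a' b', IsWeight R a' b' → a' ^ 2 + a' * b' + b' ^ 2 ≤ b ^ 2 :=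
      fun a' b' h' => by simpa using hmax a' b' h'
    obtain rfl := hc.maximal_weight_eq_two hR hb' h hmax'
    exact hc.hasModelWeights_of_maximal_weight hR h (by simpa using hmax')
  rcases hb.eq_or_lt with rfl | hb
  · right
    have h' : IsWeight (negTransposeRep R) 0 a := by
      simpa using (hR.isWeight_reflect₁₂ (hR.isWeight_reflect₀₁ h)).negTranspose
    have hmax' : ∀ a' b', IsWeight (negTransposeRep R) a' b' →
        a' ^ 2 + a' * b' + b' ^ 2 ≤ a ^ 2 :=
      fun a' b' h' => by simpa using hmax _ _ h'.of_negTranspose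
    obtain rfl := hc.negTranspose.maximal_weight_eq_two hR.negTranspose ha h' hmax'
    exact hc.negTranspose.hasModelWeights_of_maximal_weight hR.negTranspose h'
      (by simpa using hmax')
  · exfalso
    -- `λ` and its reflection make an angle less than `120°`, so that their sum is longer than `λ`.
    rcases hc.isWeight_of_isWeight hR h (hR.isWeight_reflect₀₁ h)
      (by rw [Ne, Prod.mk.injEq]; omega) with h1 | h1 | h1 <;>
    · have := hmax _ _ h1
      nlinarith [mul_pos ha hb]

end Cup

/-! ### The highest weight vector of `Sym₂(E*)` or `Her(E*)` -/

section Highest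

variable {𝕜 W : Type*} [RCLike 𝕜] [AddCommGroup W] [Module ℝ W]
  {R : Matrix (Fin 3) (Fin 3) 𝕜 →ₗ[ℝ] Module.End ℝ W}

local notation "X" => elemAct R

lemma IsGlRep.elemAct_mem (hR : IsGlRep R) (i j : Fin 3) (z : 𝕜) {a b a' b' : ℤ} {w : W}
    (hw : w ∈ wt R a b) (h : (a + (![1, -1, 0] i - ![1, -1, 0] j),
      b + (![0, 1, -1] i - ![0, 1, -1] j)) = (a', b')) : X i j z w ∈ wt R a' b' := by
  rw [Prod.mk.injEq] at h
  exact h.1 ▸ h.2 ▸ hR.elemAct_mem_wt i j z hw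

lemma HasModelWeights.elemAct_eq_zero (hM : HasModelWeights R) (hR : IsGlRep R) (i j : Fin 3)
    (z : 𝕜) {a b : ℤ} {w : W} (hw : w ∈ wt R a b) (h : (a + (![1, -1, 0] i - ![1, -1, 0] j),
      b + (![0, 1, -1] i - ![0, 1, -1] j)) ∉
      ({(0, 0), (1, 0), (-1, 1), (0, -1), (-2, 0), (2, -2), (0, 2)} : Finset (ℤ × ℤ))) :
    X i j z w = 0 := by
  by_contra h0
  exact h (hM.mem _ _ ⟨_, hR.elemAct_mem_wt i j z hw, h0⟩)

lemma elemAct_real (i j : Fin 3) (r : ℝ) (w : W) : X i j (r : 𝕜) w = r • X i j 1 w := by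
  rw [← mul_one (r : 𝕜), ← RCLike.real_smul_eq_coe_mul, map_smul, LinearMap.smul_apply]

/-- The action of `z (E_ii - E_jj)`. -/
noncomputable def cartanAct (R : Matrix (Fin 3) (Fin 3) 𝕜 →ₗ[ℝ] Module.End ℝ W) (i j : Fin 3) :
    𝕜 →ₗ[ℝ] Module.End ℝ W :=
  elemAct R i i - elemAct R j j

local notation "H" => cartanAct R

lemma cartanAct_apply (i j : Fin 3) (z : 𝕜) (w : W) : H i j z w = X i i z w - X j j z w := rfl

lemma IsGlRep.comm_opposite (hR : IsGlRep R) (i j : Fin 3) (z w : 𝕜) (u : W) :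
    X i j z (X j i w u) = X j i w (X i j z u) + H i j (z * w) u := by
  rw [hR.comm, if_pos rfl, if_pos rfl, mul_comm w z, cartanAct_apply]
  abel

lemma IsGlRep.cartanAct_elemAct (hR : IsGlRep R) (i j : Fin 3) (h : i ≠ j) (z w : 𝕜) (u : W) :
    H i j z (X j i w u) = X j i w (H i j z u) - (2 : ℝ) • X j i (z * w) u := by
  simp only [cartanAct_apply, hR.comm i i j i, hR.comm j j j i, if_neg h, if_true, map_sub,
    mul_comm w z]
  module

lemma cartanAct_one₀₁ {a b : ℤ} {w : W} (hw : w ∈ wt R a b) : H 0 1 1 w = (a : ℝ) • w :=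
  (mem_wt.1 hw).1

lemma cartanAct_one₁₂ {a b : ℤ} {w : W} (hw : w ∈ wt R a b) : H 1 2 1 w = (b : ℝ) • w :=
  (mem_wt.1 hw).2

lemma cartanAct_one₀₂ {a b : ℤ} {w : W} (hw : w ∈ wt R a b) :
    H 0 2 1 w = ((a + b : ℤ) : ℝ) • w := by
  push_cast
  rw [add_smul, ← cartanAct_one₀₁ hw, ← cartanAct_one₁₂ hw]
  simp only [cartanAct_apply]
  abel

lemma cartanAct_real (i j : Fin 3) (r : ℝ) (w : W) : H i j (r : 𝕜) w = r • H i j 1 w := by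
  simp only [cartanAct_apply, elemAct_real, smul_sub]

section

variable (hR : IsGlRep R) (hM : HasModelWeights R) {v : W} (hv : v ∈ wt R 0 2)
include hR hM hv

lemma HasModelWeights.elemAct_highest {p : Fin 3} (hp : p ≠ 2) (j : Fin 3) (hj : j ≠ p) (z : 𝕜) :
    X p j z v = 0 :=
  hM.elemAct_eq_zero hR p j z hv (by revert p j; decide)

lemma HasModelWeights.cartanAct_highest₀₁ (z : 𝕜) : H 0 1 z v = 0 := by
  have := hR.comm_opposite 0 1 z 1 v
  rwa [hM.elemAct_highest hR hv (by decide) 1 (by decide),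
    hM.elemAct_highest hR hv (by decide) 0 (by decide), map_zero, map_zero, zero_add, mul_one,
    eq_comm] at this

lemma HasModelWeights.elemAct_lower {p : Fin 3} (hp : p ≠ 2) (y z : 𝕜) :
    X p 2 y (X 2 p z v) = H p 2 (y * z) v := by
  rw [hR.comm_opposite, hM.elemAct_highest hR hv hp 2 hp.symm, map_zero, zero_add]

omit hM hv in
lemma IsGlRep.lower_mem {w : W} (hw : w ∈ wt R 0 2) (z : 𝕜) : X 2 1 z w ∈ wt R 1 0 :=
  hR.elemAct_mem 2 1 z hw (by decide)

omit hv in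
/-- On the weight space `(2, -2)`, the lowering operator `E₂₁` after the raising operator `E₁₂` is
twice the identity. -/
lemma HasModelWeights.lower_raise {w : W} (hw : w ∈ wt R 2 (-2)) :
    X 2 1 1 (X 1 2 1 w) = (2 : ℝ) • w := by
  have h1 := hR.comm_opposite 1 2 1 1 w
  rw [hM.elemAct_eq_zero hR 2 1 1 hw (by decide), map_zero, mul_one, cartanAct_one₁₂ hw] at h1
  rw [eq_neg_of_add_eq_zero_left h1.symm]
  push_cast
  module

lemma HasModelWeights.lower_injective (h0 : v ≠ 0) {z : 𝕜} (hz : X 2 1 z v = 0) : z = 0 := by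
  by_contra hz0
  have h1 := hM.elemAct_lower hR hv (p := 1) (by decide) (conj z) z
  rw [hz, map_zero, RCLike.conj_mul, ← RCLike.ofReal_pow, cartanAct_real, cartanAct_one₁₂ hv,
    smul_smul, eq_comm, smul_eq_zero] at h1
  have : ‖z‖ ≠ 0 := norm_ne_zero_iff.2 hz0
  rcases h1 with h1 | h1
  · simp [hz0] at h1
  · exact h0 h1

lemma HasModelWeights.raise_lower_lower {χ : 𝕜 → ℝ} (hχ : ∀ z, H 1 2 z v = χ z • v) (y z w : 𝕜) :
    X 1 2 y (X 2 1 z (X 2 1 w v)) =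
      χ (y * z) • X 2 1 w v + χ (y * w) • X 2 1 z v - (2 : ℝ) • X 2 1 (y * z * w) v := by
  rw [hR.comm_opposite, hM.elemAct_lower hR hv (by decide), hR.cartanAct_elemAct _ _ (by decide),
    hχ, hχ, map_smul, map_smul]
  abel

/-- The torus acts on the highest weight vector through `χ = 2 Re`: as `E₂₁(I)² v` is a real
multiple of `E₂₁(1)² v`, the value `χ(I)` vanishes. -/
lemma HasModelWeights.cartanAct_highest₁₂ (h0 : v ≠ 0) (hspan : ∀ w ∈ wt R 0 2, ∃ r : ℝ, w = r • v)
    (z : 𝕜) : H 1 2 z v = (2 * RCLike.re z) • v := by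
  have hmem : ∀ z, H 1 2 z v ∈ wt R 0 2 := fun z =>
    sub_mem (hR.elemAct_mem 1 1 z hv (by decide)) (hR.elemAct_mem 2 2 z hv (by decide))
  choose χ hχ using fun z => hspan _ (hmem z)
  have hχr : ∀ r : ℝ, χ (r : 𝕜) = 2 * r := by
    intro r
    have h1 := hχ (r : 𝕜)
    rw [cartanAct_real, cartanAct_one₁₂ hv, smul_smul] at h1
    rw [← smul_left_injective ℝ h0 h1]
    push_cast; ring
  have hχ1 : χ 1 = 2 := by simpa using hχr 1
  have form := hM.raise_lower_lower hR hv hχ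
  set x := X 2 1 1 (X 2 1 1 v) with hx
  have hxmem : ∀ z w, X 2 1 z (X 2 1 w v) ∈ wt R 2 (-2) := fun z w =>
    hR.elemAct_mem 2 1 z (hR.lower_mem hv w) (by decide)
  have hXx : X 1 2 1 x = (2 : ℝ) • X 2 1 1 v := by
    rw [hx, form, mul_one, mul_one, hχ1]; module
  have hinj : ∀ w ∈ wt R 2 (-2), X 1 2 1 w = 0 → w = 0 := fun w hw h1 => by
    have := hM.lower_raise hR hw
    rw [h1, map_zero, eq_comm, smul_eq_zero] at this
    exact this.resolve_left two_ne_zero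
  have hV1 : ∀ w ∈ wt R 2 (-2), ∃ q : ℝ, w = q • x := by
    intro w hw
    obtain ⟨s, hs⟩ := hspan _ (hR.elemAct_mem 1 2 1 (hR.elemAct_mem 1 2 1 hw rfl) (by decide))
    refine ⟨s / 4, sub_eq_zero.1 (hinj _ (sub_mem hw (Submodule.smul_mem _ _ (hxmem 1 1))) ?_)⟩
    set w' := w - (s / 4) • x with hw'
    have hw'mem : w' ∈ wt R 2 (-2) := sub_mem hw (Submodule.smul_mem _ _ (hxmem 1 1))
    have e1 : X 1 2 1 (X 1 2 1 w') = 0 := by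
      rw [hw', map_sub, map_sub, hs, map_smul, hXx, map_smul, map_smul,
        hM.elemAct_lower hR hv (by decide), mul_one, hχ, hχ1]
      module
    have e2 := hR.comm_opposite 1 2 1 1 (X 1 2 1 w')
    rw [e1, map_zero, hM.lower_raise hR hw'mem, map_smul, mul_one,
      cartanAct_one₁₂ (hR.elemAct_mem 1 2 1 hw'mem rfl : _ ∈ wt R 1 0)] at e2
    simpa using e2
  have hχI : χ RCLike.I = 0 := by
    rcases RCLike.I_eq_zero_or_im_I_eq_one (K := 𝕜) with hI | hI1
    · rw [hI]; simpa using hχr 0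
    have hI : (RCLike.I : 𝕜) * RCLike.I = -1 :=
      RCLike.I_mul_I_of_nonzero fun h => by simp [h] at hI1
    obtain ⟨q, hq⟩ := hV1 _ (hxmem RCLike.I RCLike.I)
    have e1 := form 1 RCLike.I RCLike.I
    rw [hq, map_smul, hXx, one_mul, hI, map_neg, LinearMap.neg_apply] at e1
    have e2 : X 2 1 (((2 * q - 2 : ℝ) : 𝕜) - ((2 * χ RCLike.I : ℝ) : 𝕜) * RCLike.I) v = 0 := by
      rw [← RCLike.real_smul_eq_coe_mul, map_sub, map_smul, LinearMap.sub_apply, elemAct_real,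
        LinearMap.smul_apply]
      linear_combination (norm := module) e1
    have e3 := congrArg RCLike.im (hM.lower_injective hR hv h0 e2)
    simpa [hI1] using e3
  have hdec : H 1 2 z = H 1 2 ((RCLike.re z : ℝ) : 𝕜) + RCLike.im z • H 1 2 RCLike.I := by
    rw [← map_smul, ← map_add, RCLike.real_smul_eq_coe_mul, RCLike.re_add_im]
  rw [hdec, LinearMap.add_apply, LinearMap.smul_apply, hχ, hχ, hχI, hχr, zero_smul, smul_zero,
    add_zero]

end

/-- The vector `v` spans the weight space `(0, 2)`, which is that of the highest weight of
`Sym₂(E*)` or `Her(E*)`, and is nonzero. -/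
structure IsHighest (R : Matrix (Fin 3) (Fin 3) 𝕜 →ₗ[ℝ] Module.End ℝ W) (v : W) : Prop where
  mem : v ∈ wt R 0 2
  ne_zero : v ≠ 0
  span : ∀ w ∈ wt R 0 2, ∃ r : ℝ, w = r • v

section

variable (hR : IsGlRep R) (hM : HasModelWeights R) {v : W} (hv : IsHighest R v)
include hR hM hv

lemma IsHighest.raise (i j : Fin 3) (hij : i ≠ j ∧ i ≠ 2) (z : 𝕜) : X i j z v = 0 :=
  hM.elemAct_highest hR hv.mem hij.2 j hij.1.symm z

lemma IsHighest.cartanAct {p : Fin 3} (hp : p ≠ 2) (z : 𝕜) :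
    H p 2 z v = (2 * RCLike.re z) • v := by
  have h1 := hM.cartanAct_highest₁₂ hR hv.mem hv.ne_zero hv.span z
  have h2 := hM.cartanAct_highest₀₁ hR hv.mem z
  obtain rfl | rfl : p = 0 ∨ p = 1 := by revert p; decide
  · rw [← h1, ← add_zero (H 1 2 z v), ← h2]
    simp only [cartanAct_apply]
    abel
  · exact h1

lemma IsHighest.raise_lower {p : Fin 3} (hp : p ≠ 2) (y z : 𝕜) :
    X p 2 y (X 2 p z v) = (2 * RCLike.re (y * z)) • v := by
  rw [hM.elemAct_lower hR hv.mem hp, hv.cartanAct hR hM hp]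

lemma IsHighest.raise_lower_lower {p : Fin 3} (hp : p ≠ 2) (y z w : 𝕜) :
    X p 2 y (X 2 p z (X 2 p w v)) =
      X 2 p (2 * (RCLike.re (y * z) : 𝕜) * w + 2 * (RCLike.re (y * w) : 𝕜) * z
        - 2 * (y * z * w)) v := by
  have hreal : ∀ (r : ℝ) (z : 𝕜), X 2 p (2 * (r : 𝕜) * z) v = (2 * r) • X 2 p z v := by
    intro r z
    rw [← LinearMap.smul_apply, ← map_smul, RCLike.real_smul_eq_coe_mul]
    push_cast; rfl
  have h2 := hreal 1 (y * z * w)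
  rw [RCLike.ofReal_one, mul_one, mul_one] at h2
  rw [hR.comm_opposite, hM.elemAct_lower hR hv.mem hp, hR.cartanAct_elemAct _ _ hp,
    hv.cartanAct hR hM hp, hv.cartanAct hR hM hp, map_sub, map_add, LinearMap.sub_apply,
    LinearMap.add_apply, hreal, hreal, h2, map_smul, map_smul]
  module

/-- Quadratic relation in the directions `E₂ₚ`. -/
lemma IsHighest.lower_lower {p : Fin 3} (hp : p ≠ 2) (z w : 𝕜) :
    X 2 p z (X 2 p w v) = RCLike.re (z * conj w) • X 2 p 1 (X 2 p 1 v) := by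
  rw [← sub_eq_zero]
  set d := X 2 p z (X 2 p w v) - RCLike.re (z * conj w) • X 2 p 1 (X 2 p 1 v) with hd
  have h1 : X p 2 1 d = 0 := by
    rw [hd, map_sub, map_smul, hv.raise_lower_lower hR hM hp, hv.raise_lower_lower hR hM hp,
      ← LinearMap.smul_apply, ← map_smul, ← LinearMap.sub_apply, ← map_sub]
    convert LinearMap.zero_apply (σ₁₂ := RingHom.id ℝ) v
    convert map_zero (X 2 p)
    simp only [RCLike.real_smul_eq_coe_mul, RCLike.re_eq_add_conj, map_mul, RCLike.conj_conj,
      one_mul, map_one]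
    ring
  have h2 : X 2 p 1 d = 0 ∧ H p 2 1 d = (-2 : ℝ) • d := by
    obtain rfl | rfl : p = 0 ∨ p = 1 := by clear h1 hd d; revert p; decide
    · have hmem : ∀ z w, X 2 0 z (X 2 0 w v) ∈ wt R (-2) 0 := fun z w =>
        hR.elemAct_mem 2 0 z (hR.elemAct_mem 2 0 w hv.mem rfl) (by decide)
      have hdm : d ∈ wt R (-2) 0 := sub_mem (hmem _ _) (Submodule.smul_mem _ _ (hmem _ _))
      exact ⟨hM.elemAct_eq_zero hR 2 0 1 hdm (by decide), by simpa using cartanAct_one₀₂ hdm⟩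
    · have hmem : ∀ z w, X 2 1 z (X 2 1 w v) ∈ wt R 2 (-2) := fun z w =>
        hR.elemAct_mem 2 1 z (hR.elemAct_mem 2 1 w hv.mem rfl) (by decide)
      have hdm : d ∈ wt R 2 (-2) := sub_mem (hmem _ _) (Submodule.smul_mem _ _ (hmem _ _))
      exact ⟨hM.elemAct_eq_zero hR 2 1 1 hdm (by decide), by simpa using cartanAct_one₁₂ hdm⟩
  have h3 := hR.comm_opposite p 2 1 1 d
  rw [h2.1, h1, map_zero, map_zero, mul_one, h2.2, zero_add, eq_comm, smul_eq_zero] at h3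
  exact h3.resolve_left (by norm_num)

lemma IsHighest.lower₀_lower₁ (z w : 𝕜) :
    X 2 0 z (X 2 1 w v) = X 2 0 (z * conj w) (X 2 1 1 v) := by
  rw [← sub_eq_zero]
  set d := X 2 0 z (X 2 1 w v) - X 2 0 (z * conj w) (X 2 1 1 v) with hd
  have hmem : ∀ z w, X 2 0 z (X 2 1 w v) ∈ wt R 0 (-1) := fun z w =>
    hR.elemAct_mem 2 0 z (hR.elemAct_mem 2 1 w hv.mem rfl) (by decide)
  have hdm : d ∈ wt R 0 (-1) := sub_mem (hmem _ _) (hmem _ _)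
  have hraise : ∀ z w, X 0 2 1 (X 2 0 z (X 2 1 w v)) = X 2 1 (conj z * w) v := by
    intro z w
    have h1 : X 0 2 1 (X 2 1 w v) = 0 := by
      rw [hR.comm, hv.raise hR hM 0 2 (by decide), if_pos rfl, if_neg (by decide),
        hv.raise hR hM 0 1 (by decide)]
      simp
    have h2 : H 0 2 z (X 2 1 w v) = X 2 1 w (H 0 2 z v) - X 2 1 (z * w) v := by
      simp only [cartanAct_apply, hR.comm 0 0 2 1, hR.comm 2 2 2 1, map_sub]
      simp
      abel
    have h3 : conj z * w = (2 * RCLike.re z) • w - z * w := by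
      rw [RCLike.real_smul_eq_coe_mul, RCLike.ofReal_mul, RCLike.re_eq_add_conj,
        RCLike.ofReal_ofNat]
      ring
    rw [hR.comm_opposite, h1, map_zero, one_mul, zero_add, h2, hv.cartanAct hR hM (by decide),
      h3, map_sub, map_smul, map_smul, LinearMap.sub_apply, LinearMap.smul_apply]
  have h1 : X 0 2 1 d = 0 := by
    rw [hd, map_sub, hraise, hraise, map_mul conj, RCLike.conj_conj, mul_one, sub_self]
  have h3 := hR.comm_opposite 0 2 1 1 d
  rw [hM.elemAct_eq_zero hR 2 0 1 hdm (by decide), h1, map_zero, map_zero, mul_one,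
    cartanAct_one₀₂ hdm] at h3
  simpa using h3

end
end Highest

/-! ### The map from hermitian matrices -/

section Maps

variable {𝕜 W : Type*} [RCLike 𝕜] [AddCommGroup W] [Module ℝ W]
  {R : Matrix (Fin 3) (Fin 3) 𝕜 →ₗ[ℝ] Module.End ℝ W}

local notation "X" => elemAct R
local notation "H" => cartanAct R

variable (R) in
/-- The map from hermitian matrices to `W` that sends the matrix unit `E₂₂` to `v` and is
equivariant for the action `x · A = -(xᴴ A + A x)`. Only the entries on and below the diagonal
enter the formula. -/
noncomputable def hermMap (v : W) :
    Matrix (Fin 3) (Fin 3) 𝕜 →ₗ[ℝ] W where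
  toFun A := RCLike.re (A 2 2) • v + (RCLike.re (A 1 1) / 2) • X 2 1 1 (X 2 1 1 v)
    + (RCLike.re (A 0 0) / 2) • X 2 0 1 (X 2 0 1 v) - X 2 1 (A 2 1) v - X 2 0 (A 2 0) v
    + X 2 0 (A 1 0) (X 2 1 1 v)
  map_add' A B := by
    simp only [Matrix.add_apply, map_add, LinearMap.add_apply]
    module
  map_smul' r A := by
    simp only [Matrix.smul_apply, RCLike.smul_re, map_smul, LinearMap.smul_apply, RingHom.id_apply]
    module

lemma hermMap_apply (v : W) (A : Matrix (Fin 3) (Fin 3) 𝕜) : hermMap R v A =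
    RCLike.re (A 2 2) • v + (RCLike.re (A 1 1) / 2) • X 2 1 1 (X 2 1 1 v)
    + (RCLike.re (A 0 0) / 2) • X 2 0 1 (X 2 0 1 v) - X 2 1 (A 2 1) v - X 2 0 (A 2 0) v
    + X 2 0 (A 1 0) (X 2 1 1 v) := rfl

section

variable (hR : IsGlRep R) (hM : HasModelWeights R) {v : W} (hv : IsHighest R v)
include hR hM hv

lemma IsHighest.lower_lower_lower (p q r : Fin 3) (hp : p ≠ 2) (hq : q ≠ 2) (hr : r ≠ 2)
    (x y z : 𝕜) : X 2 p x (X 2 q y (X 2 r z v)) = 0 := by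
  refine hM.elemAct_eq_zero hR 2 p x
    (hR.elemAct_mem_wt 2 q y (hR.elemAct_mem_wt 2 r z hv.mem)) ?_
  revert p q r
  decide

omit hM hv in
lemma IsGlRep.lower_comm (z w : 𝕜) (u : W) : X 2 1 z (X 2 0 w u) = X 2 0 w (X 2 1 z u) := by
  rw [hR.comm]; simp

lemma IsHighest.raise₁_lower₀ (y z : 𝕜) : X 1 2 y (X 2 0 z v) = 0 := by
  rw [hR.comm, hv.raise hR hM 1 2 (by decide), if_pos rfl, if_neg (by decide),
    hv.raise hR hM 1 0 (by decide)]
  simp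

lemma IsHighest.raise₀_lower₁ (y z : 𝕜) : X 0 2 y (X 2 1 z v) = 0 := by
  rw [hR.comm, hv.raise hR hM 0 2 (by decide), if_pos rfl, if_neg (by decide),
    hv.raise hR hM 0 1 (by decide)]
  simp

lemma IsHighest.raise₁_lower₀_lower₀ (x y z : 𝕜) : X 1 2 x (X 2 0 y (X 2 0 z v)) = 0 :=
  hM.elemAct_eq_zero hR 1 2 x
    (hR.elemAct_mem_wt 2 0 y (hR.elemAct_mem_wt 2 0 z hv.mem)) (by decide)

lemma IsHighest.raise₀_lower₁_lower₁ (x y z : 𝕜) : X 0 2 x (X 2 1 y (X 2 1 z v)) = 0 :=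
  hM.elemAct_eq_zero hR 0 2 x
    (hR.elemAct_mem_wt 2 1 y (hR.elemAct_mem_wt 2 1 z hv.mem)) (by decide)

lemma IsHighest.raise₁_lower₀_lower₁ (x y : 𝕜) :
    X 1 2 x (X 2 0 y (X 2 1 1 v)) = X 2 0 (conj x * y) v := by
  have h3 : conj x * y = (2 * RCLike.re x) • y - x * y := by
    rw [RCLike.real_smul_eq_coe_mul, RCLike.ofReal_mul, RCLike.re_eq_add_conj, RCLike.ofReal_ofNat]
    ring
  have h4 : X 1 0 (x * y) (X 2 1 1 v) = -X 2 0 (x * y) v := by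
    rw [hR.comm, hv.raise hR hM 1 0 (by decide), if_neg (by decide), if_pos rfl, one_mul]
    simp
  rw [hR.comm 1 2 2 0, hv.raise_lower hR hM (by decide), if_pos rfl, if_neg (by decide), h4, h3,
    map_sub, LinearMap.sub_apply, map_smul, map_smul, LinearMap.smul_apply, mul_one]
  abel

lemma IsHighest.raise₀_lower₀_lower₁ (x y : 𝕜) :
    X 0 2 x (X 2 0 y (X 2 1 1 v)) = X 2 1 (conj (x * y)) v := by
  have h3 : conj (x * y) = (2 * RCLike.re (x * y)) • (1 : 𝕜) - x * y := by
    rw [RCLike.real_smul_eq_coe_mul, RCLike.ofReal_mul, RCLike.re_eq_add_conj, RCLike.ofReal_ofNat]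
    ring
  have h2 : H 0 2 (x * y) (X 2 1 1 v) = X 2 1 1 (H 0 2 (x * y) v) - X 2 1 (x * y) v := by
    simp only [cartanAct_apply, hR.comm 0 0 2 1, hR.comm 2 2 2 1, map_sub]
    simp
    abel
  rw [hR.comm_opposite, hv.raise₀_lower₁ hR hM, map_zero, zero_add, h2,
    hv.cartanAct hR hM (by decide), h3]
  simp only [map_smul, map_sub, LinearMap.sub_apply, LinearMap.smul_apply]

lemma IsHighest.raise_lower_lower_one {p : Fin 3} (hp : p ≠ 2) (y : 𝕜) :
    X p 2 y (X 2 p 1 (X 2 p 1 v)) = (2 : ℝ) • X 2 p (conj y) v := by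
  rw [hv.raise_lower_lower hR hM hp, ← LinearMap.smul_apply, ← map_smul,
    RCLike.real_smul_eq_coe_mul, RCLike.ofReal_ofNat, RCLike.re_eq_add_conj]
  simp only [mul_one]
  congr 2
  ring

variable {A : Matrix (Fin 3) (Fin 3) 𝕜} (hA : Aᴴ = A)
include hA

lemma IsHighest.hermMap_lower₁ (z : 𝕜) :
    hermMap R v (-((Matrix.single 2 1 z)ᴴ * A + A * Matrix.single 2 1 z)) =
      X 2 1 z (hermMap R v A) := by
  have hA' : ∀ i j, A i j = conj (A j i) := fun i j => congrFun₂ hA.symm i j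
  have hd : ∀ i (w : 𝕜), A i i * w = RCLike.re (A i i) • w := fun i w => by
    rw [RCLike.real_smul_eq_coe_mul, RCLike.conj_eq_iff_re.1 (hA' i i).symm]
  have hlll : ∀ (p q r : Fin 3) (x y z : 𝕜), p ≠ 2 ∧ q ≠ 2 ∧ r ≠ 2 →
      X 2 p x (X 2 q y (X 2 r z v)) = 0 := fun p q r x y z h =>
    hv.lower_lower_lower hR hM p q r h.1 h.2.1 h.2.2 x y z
  simp only [hermMap_apply, map_add, map_sub, map_smul, hlll 1 1 1 _ _ _ (by decide),
    hlll 1 0 0 _ _ _ (by decide),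
    hlll 1 0 1 _ _ _ (by decide),
    hR.lower_comm, hv.lower_lower hR hM (p := 1) (by decide) z, hv.lower₀_lower₁ hR hM _ z]
  simp [Matrix.mul_apply, Matrix.single_apply, hd, hA' 1 2]
  rw [mul_comm (conj z)]
  module

lemma IsHighest.hermMap_lower₀ (z : 𝕜) :
    hermMap R v (-((Matrix.single 2 0 z)ᴴ * A + A * Matrix.single 2 0 z)) =
      X 2 0 z (hermMap R v A) := by
  have hA' : ∀ i j, A i j = conj (A j i) := fun i j => congrFun₂ hA.symm i j
  have hd : ∀ i (w : 𝕜), A i i * w = RCLike.re (A i i) • w := fun i w => by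
    rw [RCLike.real_smul_eq_coe_mul, RCLike.conj_eq_iff_re.1 (hA' i i).symm]
  have hlll : ∀ (p q r : Fin 3) (x y z : 𝕜), p ≠ 2 ∧ q ≠ 2 ∧ r ≠ 2 →
      X 2 p x (X 2 q y (X 2 r z v)) = 0 := fun p q r x y z h =>
    hv.lower_lower_lower hR hM p q r h.1 h.2.1 h.2.2 x y z
  simp only [hermMap_apply, map_add, map_sub, map_smul, hlll 0 1 1 _ _ _ (by decide),
    hlll 0 0 0 _ _ _ (by decide),
    hlll 0 0 1 _ _ _ (by decide),
    hv.lower_lower hR hM (p := 0) (by decide) z, hv.lower₀_lower₁ hR hM z]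
  simp [Matrix.mul_apply, Matrix.single_apply, hd, hA' 1 2, hA' 0 2]
  rw [mul_comm z (conj _)]
  module

lemma IsHighest.hermMap_raise₁ (z : 𝕜) :
    hermMap R v (-((Matrix.single 1 2 z)ᴴ * A + A * Matrix.single 1 2 z)) =
      X 1 2 z (hermMap R v A) := by
  have hA' : ∀ i j, A i j = conj (A j i) := fun i j => congrFun₂ hA.symm i j
  have hd' : ∀ i (w : 𝕜), w * A i i = RCLike.re (A i i) • w := fun i w => by
    rw [mul_comm, RCLike.real_smul_eq_coe_mul, RCLike.conj_eq_iff_re.1 (hA' i i).symm]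
  simp only [hermMap_apply, map_add, map_sub, map_smul, hv.raise₁_lower₀ hR hM,
    hv.raise_lower hR hM (p := 1) (by decide), hv.raise hR hM 1 2 (by decide),
    hv.raise₁_lower₀_lower₀ hR hM,
    hv.raise₁_lower₀_lower₁ hR hM, hv.raise_lower_lower_one hR hM (p := 1) (by decide)]
  simp [Matrix.mul_apply, Matrix.single_apply, hd', hA' 1 2]
  module

lemma IsHighest.hermMap_raise₀ (z : 𝕜) :
    hermMap R v (-((Matrix.single 0 2 z)ᴴ * A + A * Matrix.single 0 2 z)) =
      X 0 2 z (hermMap R v A) := by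
  have hA' : ∀ i j, A i j = conj (A j i) := fun i j => congrFun₂ hA.symm i j
  have hd' : ∀ i (w : 𝕜), w * A i i = RCLike.re (A i i) • w := fun i w => by
    rw [mul_comm, RCLike.real_smul_eq_coe_mul, RCLike.conj_eq_iff_re.1 (hA' i i).symm]
  simp only [hermMap_apply, map_add, map_sub, map_smul, hv.raise₀_lower₁ hR hM,
    hv.raise_lower hR hM (p := 0) (by decide), hv.raise hR hM 0 2 (by decide),
    hv.raise₀_lower₁_lower₁ hR hM,
    hv.raise₀_lower₀_lower₁ hR hM, hv.raise_lower_lower_one hR hM (p := 0) (by decide)]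
  simp [Matrix.mul_apply, Matrix.single_apply, hd', hA' 0 2, hA' 0 1]
  module

end
end Maps

/-! ### Highest weight vectors of the standard representation -/

section Standard

variable {𝕜 W : Type*} [RCLike 𝕜] [AddCommGroup W] [Module ℝ W]
  {R : Matrix (Fin 3) (Fin 3) 𝕜 →ₗ[ℝ] Module.End ℝ W}

local notation "X" => elemAct R
local notation "H" => cartanAct R

variable (R) in
/-- The highest weight vectors for the weight of the first basis vector of `E`. -/
noncomputable def stdHighest : Submodule ℝ W where
  carrier := {w | w ∈ wt R 1 0 ∧ ∀ z, X 1 2 z w = 0}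
  add_mem' h h' := ⟨add_mem h.1 h'.1, fun z => by rw [map_add, h.2, h'.2, add_zero]⟩
  zero_mem' := ⟨zero_mem _, fun z => map_zero _⟩
  smul_mem' r _ h := ⟨Submodule.smul_mem _ r h.1, fun z => by rw [map_smul, h.2, smul_zero]⟩

variable (R) in
/-- The map `E → W` sending the first basis vector to `k`. It is equivariant if `k` lies in
`stdHighest R`, and complex linear for the action of `i(E₀₀ - E₁₁)` as complex structure. -/
noncomputable def stdMap (k : W) : (Fin 3 → 𝕜) →ₗ[ℝ] W where
  toFun a := H 0 1 (a 0) k + X 1 0 (a 1) k + X 2 0 (a 2) k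
  map_add' a b := by
    simp only [Pi.add_apply, map_add, LinearMap.add_apply]
    abel
  map_smul' r a := by
    simp only [Pi.smul_apply, map_smul, LinearMap.smul_apply, RingHom.id_apply, smul_add]

lemma stdMap_apply (k : W) (a : Fin 3 → 𝕜) :
    stdMap R k a = H 0 1 (a 0) k + X 1 0 (a 1) k + X 2 0 (a 2) k := rfl

variable (hR : IsGlRep R) (hM : HasModelWeights R)
include hR hM

omit hM in
lemma IsGlRep.cartanAct_mem (i j : Fin 3) (z : 𝕜) {a b : ℤ} {w : W} (hw : w ∈ wt R a b) :
    H i j z w ∈ wt R a b := by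
  have h : ∀ i, X i i z w ∈ wt R a b := fun i => by
    simpa only [sub_self, add_zero] using hR.elemAct_mem_wt i i z hw
  exact sub_mem (h i) (h j)

/-- On the weight space of the first basis vector of `E`, the actions of `z(E₀₀ - E_pp)` are
determined by the lowering operators. -/
lemma HasModelWeights.lower_cartanAct {p : Fin 3} (hp : p ≠ 0) (z : 𝕜) {u : W}
    (hu : u ∈ wt R 1 0) : X p 0 1 (H 0 p z u) = X p 0 z u := by
  have hmem : X p 0 z u ∈ wt R (![1, -1, 0] p) (![0, 1, -1] p) :=
    hR.elemAct_mem p 0 z hu (by revert p; decide)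
  have h1 : X 0 p 1 u = 0 := hM.elemAct_eq_zero hR 0 p 1 hu (by clear hmem; revert p; decide)
  have h2 : X p 0 1 (X p 0 z u) = 0 :=
    hM.elemAct_eq_zero hR p 0 1 hmem (by clear h1 hmem; revert p; decide)
  have h3 : H 0 p 1 (X p 0 z u) = (-1 : ℝ) • X p 0 z u := by
    obtain rfl | rfl : p = 1 ∨ p = 2 := by clear h1 h2 hmem; revert p; decide
    · simpa using cartanAct_one₀₁ hmem
    · simpa using cartanAct_one₀₂ hmem
  have h4 := hR.comm_opposite 0 p 1 1 (X p 0 z u)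
  have h5 := hR.comm_opposite 0 p 1 z u
  rw [h1, map_zero, zero_add, one_mul] at h5
  rw [h2, map_zero, h5, mul_one, h3] at h4
  rw [eq_neg_of_add_eq_zero_left h4.symm]
  simp

lemma HasModelWeights.cartanAct_mul {p : Fin 3} (hp : p ≠ 0) (y z : 𝕜) {u : W}
    (hu : u ∈ wt R 1 0) : H 0 p y (H 0 p z u) = H 0 p (y * z) u := by
  have hz : ∀ x, ∀ u ∈ wt R 1 0, X 0 p x u = 0 := fun x u hu =>
    hM.elemAct_eq_zero hR 0 p x hu (by revert p; decide)
  have h1 := hR.comm_opposite 0 p y z u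
  have h2 := hR.comm_opposite 0 p y 1 (H 0 p z u)
  rw [hz _ _ hu, map_zero, zero_add] at h1
  rw [hz _ _ (hR.cartanAct_mem 0 p z hu), map_zero, zero_add, mul_one,
    hM.lower_cartanAct hR hp z hu, h1] at h2
  exact h2.symm

variable {k : W} (hk : k ∈ stdHighest R)
include hk

lemma HasModelWeights.std_lower (z : 𝕜) : X 2 1 z k = 0 := by
  have hmem : ∀ z, X 2 1 z k ∈ wt R 2 (-2) := fun z => hR.elemAct_mem 2 1 z hk.1 (by decide)
  have hinj : ∀ z, X 1 2 1 (X 2 1 z k) = 0 → X 2 1 z k = 0 := fun z h => by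
    have := hM.lower_raise hR (hmem z)
    rw [h, map_zero, eq_comm, smul_eq_zero] at this
    exact this.resolve_left two_ne_zero
  have h1 : X 2 1 1 k = 0 := hinj _ (by
    rw [hR.comm_opposite, hk.2, map_zero, mul_one, cartanAct_one₁₂ hk.1]; simp)
  have h2 : H 1 2 z k = 0 := by
    have := hR.comm_opposite 1 2 z 1 k
    rwa [h1, hk.2, map_zero, map_zero, zero_add, mul_one, eq_comm] at this
  exact hinj _ (by rw [hR.comm_opposite, hk.2, map_zero, one_mul, h2, zero_add])

lemma HasModelWeights.std_cartanAct₁₂ (z : 𝕜) : H 1 2 z k = 0 := by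
  have := hR.comm_opposite 1 2 z 1 k
  rwa [hM.std_lower hR hk, hk.2, map_zero, map_zero, zero_add, mul_one, eq_comm] at this

lemma HasModelWeights.std_cartanAct₀₂ (z : 𝕜) : H 0 2 z k = H 0 1 z k := by
  rw [← add_zero (H 0 1 z k), ← hM.std_cartanAct₁₂ hR hk z]
  simp only [cartanAct_apply]
  abel

omit hM in
lemma IsGlRep.cartanAct_mem_stdHighest (z : 𝕜) : H 0 1 z k ∈ stdHighest R := by
  refine ⟨hR.cartanAct_mem 0 1 z hk.1, fun y => ?_⟩
  simp only [cartanAct_apply, map_sub, hR.comm 1 2, hk.2, map_zero]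
  simp

lemma HasModelWeights.stdMap_lower₁ (z : 𝕜) (a : Fin 3 → 𝕜) :
    stdMap R k (Matrix.single 2 1 z *ᵥ a) = X 2 1 z (stdMap R k a) := by
  have h1 : X 2 1 z (X 2 0 (a 2) k) = 0 := by
    rw [hR.comm, hM.std_lower hR hk]; simp
  have h2 : X 2 1 z (X 1 0 (a 1) k) = X 2 0 (z * a 1) k := by
    rw [hR.comm, hM.std_lower hR hk]; simp
  rw [stdMap_apply, stdMap_apply, map_add, map_add, h1, h2,
    hM.std_lower hR (hR.cartanAct_mem_stdHighest hk _)]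
  simp [Matrix.mulVec, dotProduct, Matrix.single_apply]

omit hM in
lemma IsGlRep.stdMap_raise₁ (z : 𝕜) (a : Fin 3 → 𝕜) :
    stdMap R k (Matrix.single 1 2 z *ᵥ a) = X 1 2 z (stdMap R k a) := by
  have h1 : X 1 2 z (X 2 0 (a 2) k) = X 1 0 (z * a 2) k := by
    rw [hR.comm, hk.2]; simp
  have h2 : X 1 2 z (X 1 0 (a 1) k) = 0 := by
    rw [hR.comm, hk.2]; simp
  rw [stdMap_apply, stdMap_apply, map_add, map_add, h1, h2,
    (hR.cartanAct_mem_stdHighest hk _).2]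
  simp [Matrix.mulVec, dotProduct, Matrix.single_apply]

lemma HasModelWeights.stdMap_raise₀ (z : 𝕜) (a : Fin 3 → 𝕜) :
    stdMap R k (Matrix.single 0 2 z *ᵥ a) = X 0 2 z (stdMap R k a) := by
  have h0 : ∀ u ∈ wt R 1 0, X 0 2 z u = 0 := fun u hu => hM.elemAct_eq_zero hR 0 2 z hu (by decide)
  have h1 : X 0 2 z (X 2 0 (a 2) k) = H 0 1 (z * a 2) k := by
    rw [hR.comm_opposite, h0 _ hk.1, map_zero, zero_add, hM.std_cartanAct₀₂ hR hk]
  have h2 : X 0 2 z (X 1 0 (a 1) k) = 0 := by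
    rw [hR.comm, h0 _ hk.1]; simp [hk.2]
  rw [stdMap_apply, stdMap_apply, map_add, map_add, h1, h2, h0 _ (hR.cartanAct_mem 0 1 _ hk.1)]
  simp [Matrix.mulVec, dotProduct, Matrix.single_apply]

lemma HasModelWeights.stdMap_lower₀ (z : 𝕜) (a : Fin 3 → 𝕜) :
    stdMap R k (Matrix.single 2 0 z *ᵥ a) = X 2 0 z (stdMap R k a) := by
  -- A vector of weight `-2ε₀` is determined by its image under `E₀₂`.
  have hinj : ∀ w ∈ wt R (-2) 0, X 0 2 1 w = 0 → w = 0 := by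
    intro w hw h
    have h1 := hR.comm_opposite 0 2 1 1 w
    rw [h, hM.elemAct_eq_zero hR 2 0 1 hw (by decide), map_zero, map_zero, zero_add, mul_one,
      cartanAct_one₀₂ hw] at h1
    simpa using h1
  have hz : ∀ y, X 0 2 y k = 0 := fun y => hM.elemAct_eq_zero hR 0 2 y hk.1 (by decide)
  have hXH : ∀ y w, X 2 0 y (H 0 1 w k) = X 2 0 (y * w) k := by
    intro y w
    have hk' := hR.cartanAct_mem_stdHighest hk w
    rw [← hM.lower_cartanAct hR (by decide) y hk'.1, hM.std_cartanAct₀₂ hR hk',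
      hM.cartanAct_mul hR (by decide) _ _ hk.1, ← hM.std_cartanAct₀₂ hR hk,
      hM.lower_cartanAct hR (by decide) _ hk.1]
  have h1 : X 2 0 z (X 1 0 (a 1) k) = 0 := by
    refine hinj _ (hR.elemAct_mem 2 0 z (hR.elemAct_mem 1 0 (a 1) hk.1 rfl) (by decide)) ?_
    have e1 : X 0 2 1 (X 1 0 (a 1) k) = 0 := by
      rw [hR.comm, hz]; simp [hk.2]
    have e2 : H 0 2 z (X 1 0 (a 1) k) = X 1 0 (a 1) (H 0 1 z k) - X 1 0 (z * a 1) k := by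
      rw [← hM.std_cartanAct₀₂ hR hk]
      simp only [cartanAct_apply, hR.comm 0 0 1 0, hR.comm 2 2 1 0, map_sub]
      simp [mul_comm]
      abel
    have hXH' : X 1 0 (a 1) (H 0 1 z k) = X 1 0 (a 1 * z) k := by
      rw [← hM.lower_cartanAct hR (by decide) _ (hR.cartanAct_mem_stdHighest hk z).1,
        hM.cartanAct_mul hR (by decide) _ _ hk.1, hM.lower_cartanAct hR (by decide) _ hk.1]
    rw [hR.comm_opposite, e1, map_zero, zero_add, one_mul, e2, hXH', mul_comm, sub_self]
  have h2 : X 2 0 z (X 2 0 (a 2) k) = 0 :=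
    hM.elemAct_eq_zero hR 2 0 z (hR.elemAct_mem_wt 2 0 (a 2) hk.1) (by decide)
  rw [stdMap_apply, stdMap_apply, map_add, map_add, h1, h2, hXH]
  simp [Matrix.mulVec, dotProduct, Matrix.single_apply]

end Standard

/-! ### Equivariance and generation -/

section Generation

variable {𝕜 : Type*} [RCLike 𝕜]

/-- The matrices `z E_{p2}` and `z E_{2p}` with `p ≠ 2` generate `sl₃`. -/
lemma mem_of_commutator_mem (T : Submodule ℝ (Matrix (Fin 3) (Fin 3) 𝕜))
    (hT : ∀ x ∈ T, ∀ y ∈ T, x * y - y * x ∈ T)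
    (h21 : ∀ z, Matrix.single 2 1 z ∈ T) (h12 : ∀ z, Matrix.single 1 2 z ∈ T)
    (h20 : ∀ z, Matrix.single 2 0 z ∈ T) (h02 : ∀ z, Matrix.single 0 2 z ∈ T)
    {x : Matrix (Fin 3) (Fin 3) 𝕜} (hx : x.trace = 0) : x ∈ T := by
  have h01 : ∀ z, Matrix.single 0 1 z ∈ T := fun z => by
    simpa using hT _ (h02 z) _ (h21 1)
  have h10 : ∀ z, Matrix.single 1 0 z ∈ T := fun z => by
    simpa using hT _ (h12 z) _ (h20 1)
  have d0 : ∀ z, Matrix.single 0 0 z - Matrix.single 2 2 z ∈ T := fun z => by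
    simpa using hT _ (h02 z) _ (h20 1)
  have d1 : ∀ z, Matrix.single 1 1 z - Matrix.single 2 2 z ∈ T := fun z => by
    simpa using hT _ (h12 z) _ (h21 1)
  have hx22 : x 2 2 = -x 0 0 - x 1 1 := by
    rw [Matrix.trace_fin_three] at hx
    linear_combination hx
  have hdec : x = Matrix.single 0 1 (x 0 1) + Matrix.single 0 2 (x 0 2)
      + Matrix.single 1 0 (x 1 0) + Matrix.single 1 2 (x 1 2) + Matrix.single 2 0 (x 2 0)
      + Matrix.single 2 1 (x 2 1) + (Matrix.single 0 0 (x 0 0) - Matrix.single 2 2 (x 0 0))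
      + (Matrix.single 1 1 (x 1 1) - Matrix.single 2 2 (x 1 1)) := by
    ext i j
    fin_cases i <;> fin_cases j <;> simp [hx22, sub_eq_add_neg]
  rw [hdec]
  exact add_mem (add_mem (add_mem (add_mem (add_mem (add_mem (add_mem (h01 _) (h02 _)) (h10 _))
    (h12 _)) (h20 _)) (h21 _)) (d0 _)) (d1 _)

end Generation

section Classification

variable {𝕜 W : Type*} [RCLike 𝕜] [AddCommGroup W] [Module ℝ W]
  {R : Matrix (Fin 3) (Fin 3) 𝕜 →ₗ[ℝ] Module.End ℝ W}

local notation "X" => elemAct R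
local notation "H" => cartanAct R

variable (hR : IsGlRep R) (hM : HasModelWeights R)
include hR hM

lemma IsHighest.hermMap_act {v : W} (hv : IsHighest R v) {x : Matrix (Fin 3) (Fin 3) 𝕜}
    (hx : x.trace = 0) {A : Matrix (Fin 3) (Fin 3) 𝕜} (hA : Aᴴ = A) :
    hermMap R v (-(xᴴ * A + A * x)) = R x (hermMap R v A) := by
  let T : Submodule ℝ (Matrix (Fin 3) (Fin 3) 𝕜) :=
    { carrier := {x | ∀ A : Matrix (Fin 3) (Fin 3) 𝕜, Aᴴ = A →
        hermMap R v (-(xᴴ * A + A * x)) = R x (hermMap R v A)}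
      add_mem' := fun {x y} hx hy A hA => by
        rw [map_add, LinearMap.add_apply, ← hx A hA, ← hy A hA, ← map_add, conjTranspose_add]
        congr 1
        noncomm_ring
      zero_mem' := fun A _ => by simp
      smul_mem' := fun r x hx A hA => by
        rw [map_smul, LinearMap.smul_apply, ← hx A hA, ← map_smul, conjTranspose_smul]
        congr 1
        simp [smul_add] }
  refine mem_of_commutator_mem T ?_ (fun z A hA => hv.hermMap_lower₁ hR hM hA z)
    (fun z A hA => hv.hermMap_raise₁ hR hM hA z) (fun z A hA => hv.hermMap_lower₀ hR hM hA z)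
    (fun z A hA => hv.hermMap_raise₀ hR hM hA z) hx A hA
  intro x hx y hy A hA
  have hself : ∀ z : Matrix (Fin 3) (Fin 3) 𝕜, (-(zᴴ * A + A * z))ᴴ = -(zᴴ * A + A * z) := by
    intro z
    simp [hA, add_comm]
  rw [hR, ← hx A hA, ← hy A hA, ← hx _ (hself y), ← hy _ (hself x), ← map_sub]
  congr 1
  simp only [conjTranspose_sub, conjTranspose_mul]
  noncomm_ring

lemma HasModelWeights.stdMap_act {k : W} (hk : k ∈ stdHighest R) {x : Matrix (Fin 3) (Fin 3) 𝕜}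
    (hx : x.trace = 0) (a : Fin 3 → 𝕜) : stdMap R k (x *ᵥ a) = R x (stdMap R k a) := by
  let T : Submodule ℝ (Matrix (Fin 3) (Fin 3) 𝕜) :=
    { carrier := {x | ∀ a, stdMap R k (x *ᵥ a) = R x (stdMap R k a)}
      add_mem' := fun {x y} hx hy a => by
        rw [map_add, LinearMap.add_apply, ← hx a, ← hy a, ← map_add, Matrix.add_mulVec]
      zero_mem' := fun a => by simp
      smul_mem' := fun r x hx a => by
        rw [map_smul, LinearMap.smul_apply, ← hx a, ← map_smul, Matrix.smul_mulVec] }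
  refine mem_of_commutator_mem T ?_ (fun z => hM.stdMap_lower₁ hR hk z)
    (fun z => hR.stdMap_raise₁ hk z) (fun z => hM.stdMap_lower₀ hR hk z)
    (fun z => hM.stdMap_raise₀ hR hk z) hx a
  intro x hx y hy a
  rw [hR, ← hx a, ← hy a, ← hx, ← hy, ← map_sub, Matrix.sub_mulVec, Matrix.mulVec_mulVec,
    Matrix.mulVec_mulVec]

lemma HasModelWeights.act_eq_zero {w : W} (hw : w ∈ wt R 0 0) {x : Matrix (Fin 3) (Fin 3) 𝕜}
    (hx : x.trace = 0) : R x w = 0 := by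
  refine mem_of_commutator_mem (LinearMap.ker (R.flip w)) ?_
    (fun z => hM.elemAct_eq_zero hR 2 1 z hw (by decide))
    (fun z => hM.elemAct_eq_zero hR 1 2 z hw (by decide))
    (fun z => hM.elemAct_eq_zero hR 2 0 z hw (by decide))
    (fun z => hM.elemAct_eq_zero hR 0 2 z hw (by decide)) hx
  intro x (hx : R x w = 0) y (hy : R y w = 0)
  change R _ w = 0
  rw [hR, hx, hy, map_zero, map_zero, sub_self]

omit hM in
/-- If `E_qp` kills `w`, then `E_qp E_pq w` is a multiple of `w`. -/
lemma IsGlRep.lower_raise_of_eq_zero {p q : Fin 3} {w : W} {c : ℝ} (h : X q p 1 w = 0)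
    (hc : H p q 1 w = c • w) : X q p 1 (X p q 1 w) = -(c • w) := by
  have := hR.comm_opposite p q 1 1 w
  rw [h, map_zero, mul_one, hc] at this
  exact eq_neg_of_add_eq_zero_left this.symm

/-- Every vector of the weight of the first basis vector of `E` is the sum of a vector obtained
from `v` by lowering and of a highest weight vector. -/
lemma IsHighest.sub_mem_stdHighest {v : W} (hv : IsHighest R v) {u : W} (hu : u ∈ wt R 1 0) :
    ∃ z : 𝕜, u - X 2 1 z v ∈ stdHighest R := by
  obtain ⟨r, hr⟩ := hv.span _ (hR.elemAct_mem 1 2 1 hu (by decide))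
  obtain ⟨s, hs⟩ := hv.span _ (hR.elemAct_mem 1 2 RCLike.I hu (by decide))
  refine ⟨((r / 2 : ℝ) : 𝕜) - ((s / 2 : ℝ) : 𝕜) * RCLike.I,
    sub_mem hu (hR.lower_mem hv.mem _), fun y => ?_⟩
  have hy : X 1 2 y u = RCLike.re y • X 1 2 1 u + RCLike.im y • X 1 2 RCLike.I u := by
    simp only [← LinearMap.smul_apply, ← map_smul (X 1 2), ← LinearMap.add_apply, ← map_add]
    rw [RCLike.real_smul_eq_coe_mul, RCLike.real_smul_eq_coe_mul, mul_one, RCLike.re_add_im]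
  rw [map_sub, hv.raise_lower hR hM (by decide), hy, hr, hs, sub_eq_zero, smul_smul, smul_smul,
    ← add_smul]
  congr 1
  have hI := RCLike.I_im y
  simp only [RCLike.mul_re, map_sub, RCLike.ofReal_re, RCLike.I_re,
    RCLike.ofReal_im, RCLike.im_ofReal_mul]
  linear_combination (-s) * hI

/-- A subspace stable under `sl₃` is everything as soon as it contains the highest weight
vectors. -/
lemma IsHighest.eq_top [FiniteDimensional ℝ W] {v : W} (hv : IsHighest R v) (N : Submodule ℝ W)
    (hN : ∀ i j z, i ≠ j → ∀ w ∈ N, X i j z w ∈ N) (hvN : v ∈ N) (hstd : stdHighest R ≤ N)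
    (htriv : wt R 0 0 ≤ N) : N = ⊤ := by
  have hU₀ : wt R 1 0 ≤ N := fun u hu => by
    obtain ⟨z, hz⟩ := hv.sub_mem_stdHighest hR hM hu
    rw [← sub_add_cancel u (X 2 1 z v)]
    exact add_mem (hstd hz) (hN 2 1 z (by decide) v hvN)
  have key : ∀ (p q : Fin 3) (w : W) (c : ℝ), p ≠ q → c ≠ 0 → X q p 1 w = 0 →
      H p q 1 w = c • w → X p q 1 w ∈ N → w ∈ N := by
    intro p q w c hpq hc h1 h2 h3
    have h4 := hN q p 1 hpq.symm _ h3
    rw [hR.lower_raise_of_eq_zero h1 h2, neg_mem_iff] at h4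
    exact (Submodule.smul_mem_iff _ hc).1 h4
  have hU₁ : wt R (-1) 1 ≤ N := fun w hw =>
    key 0 1 w (-1) (by decide) (by norm_num) (hM.elemAct_eq_zero hR 1 0 1 hw (by decide))
      (by simpa using cartanAct_one₀₁ hw) (hU₀ (hR.elemAct_mem 0 1 1 hw (by decide)))
  have hU₂ : wt R 0 (-1) ≤ N := fun w hw =>
    key 0 2 w (-1) (by decide) (by norm_num) (hM.elemAct_eq_zero hR 2 0 1 hw (by decide))
      (by simpa using cartanAct_one₀₂ hw) (hU₀ (hR.elemAct_mem 0 2 1 hw (by decide)))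
  have hV₁ : wt R 2 (-2) ≤ N := fun w hw =>
    key 1 2 w (-2) (by decide) (by norm_num) (hM.elemAct_eq_zero hR 2 1 1 hw (by decide))
      (by simpa using cartanAct_one₁₂ hw) (hU₀ (hR.elemAct_mem 1 2 1 hw (by decide)))
  have hV₀ : wt R (-2) 0 ≤ N := fun w hw =>
    key 0 2 w (-2) (by decide) (by norm_num) (hM.elemAct_eq_zero hR 2 0 1 hw (by decide))
      (by simpa using cartanAct_one₀₂ hw) (hU₁ (hR.elemAct_mem 0 2 1 hw (by decide)))
  have hV₂ : wt R 0 2 ≤ N := fun w hw => by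
    obtain ⟨r, rfl⟩ := hv.span w hw
    exact N.smul_mem r hvN
  refine eq_top_iff.2 fun w _ => hR.induction_wt (fun a b w hw => ?_) w
  by_cases h0 : w = 0
  · rw [h0]; exact zero_mem N
  have hab := hM.mem a b ⟨w, hw, h0⟩
  simp only [Finset.mem_insert, Finset.mem_singleton, Prod.mk.injEq] at hab
  rcases hab with ⟨rfl, rfl⟩ | ⟨rfl, rfl⟩ | ⟨rfl, rfl⟩ | ⟨rfl, rfl⟩ | ⟨rfl, rfl⟩ | ⟨rfl, rfl⟩ |
    ⟨rfl, rfl⟩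
  exacts [htriv hw, hU₀ hw, hU₁ hw, hU₂ hw, hV₀ hw, hV₁ hw, hV₂ hw]

end Classification

/-! ### Classification of the representations with the weights of the model -/

section Model

variable {𝕜 W : Type*} [RCLike 𝕜] [AddCommGroup W] [Module ℝ W]
  {R : Matrix (Fin 3) (Fin 3) 𝕜 →ₗ[ℝ] Module.End ℝ W}

local notation "X" => elemAct R
local notation "H" => cartanAct R

/-- The elements `z(E₀₀ - E₁₁)` turn the space of highest weight vectors into a vector space over
`𝕜`, which has a basis. -/
lemma HasModelWeights.exists_stdHighest_basis [FiniteDimensional ℝ W] (hR : IsGlRep R)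
    (hM : HasModelWeights R) : ∃ (n : ℕ) (κ : Fin n → W), (∀ j, κ j ∈ stdHighest R) ∧
      (∀ c : Fin n → 𝕜, ∑ j, H 0 1 (c j) (κ j) = 0 → c = 0) ∧
      ∀ w ∈ stdHighest R, ∃ c : Fin n → 𝕜, w = ∑ j, H 0 1 (c j) (κ j) := by
  let φ : 𝕜 →+* Module.End ℝ (stdHighest R) :=
    { toFun := fun c => (H 0 1 c).restrict fun k hk => hR.cartanAct_mem_stdHighest hk c
      map_one' := LinearMap.ext fun k => Subtype.ext (by
        simpa using cartanAct_one₀₁ k.2.1)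
      map_mul' := fun a b => LinearMap.ext fun k => Subtype.ext
        (hM.cartanAct_mul hR (by decide) a b k.2.1).symm
      map_zero' := LinearMap.ext fun k => Subtype.ext (by simp)
      map_add' := fun a b => LinearMap.ext fun k => Subtype.ext (by simp) }
  let _ : Module 𝕜 (stdHighest R) := Module.compHom _ φ
  have hsmul : ∀ (c : 𝕜) (k : stdHighest R), ((c • k : stdHighest R) : W) = H 0 1 c k :=
    fun c k => rfl
  have : IsScalarTower ℝ 𝕜 (stdHighest R) := ⟨fun r c k => Subtype.ext (by
    rw [hsmul, map_smul]; rfl)⟩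
  have : Module.Finite 𝕜 (stdHighest R) := Module.Finite.of_restrictScalars_finite ℝ 𝕜 _
  let b := Module.finBasis 𝕜 (stdHighest R)
  have hsum : ∀ c : Fin _ → 𝕜,
      ((∑ j, c j • b j : stdHighest R) : W) = ∑ j, H 0 1 (c j) (b j : W) := by
    intro c
    rw [Submodule.coe_sum]
    rfl
  refine ⟨_, fun j => (b j : W), fun j => (b j).2, fun c hc => ?_, fun w hw => ?_⟩
  · have h1 : ∑ j, c j • b j = 0 := Subtype.ext (by rw [hsum, hc]; rfl)
    exact funext (Fintype.linearIndependent_iff.1 b.linearIndependent c h1)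
  · exact ⟨b.repr ⟨w, hw⟩, by rw [← hsum, b.sum_repr]⟩

/-- Vectors in the seven weight spaces of the model are linearly independent. -/
lemma eq_zero_of_sum_eq_zero {w : Fin 7 → W} (h0 : w 0 ∈ wt R 0 0) (h1 : w 1 ∈ wt R 1 0)
    (h2 : w 2 ∈ wt R (-1) 1) (h3 : w 3 ∈ wt R 0 (-1)) (h4 : w 4 ∈ wt R (-2) 0)
    (h5 : w 5 ∈ wt R 2 (-2)) (h6 : w 6 ∈ wt R 0 2) (h : ∑ i, w i = 0) (i : Fin 7) : w i = 0 := by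
  -- The seven weights take different values on `diag(1, 2, -3)`.
  let D : Module.End ℝ W := H 0 1 1 + (3 : ℝ) • H 1 2 1
  have hD : ∀ {a b : ℤ} {w : W}, w ∈ wt R a b → D w = ((a + 3 * b : ℤ) : ℝ) • w := by
    intro a b w hw
    simp only [D, LinearMap.add_apply, LinearMap.smul_apply, cartanAct_one₀₁ hw,
      cartanAct_one₁₂ hw]
    push_cast
    module
  let μ : Fin 7 → ℤ := ![0, 1, 2, -3, -2, -4, 6]
  have hμ : Function.Injective (fun i => (μ i : ℝ)) :=
    Int.cast_injective.comp (by decide : Function.Injective ![(0 : ℤ), 1, 2, -3, -2, -4, 6])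
  have hmem : ∀ i, w i ∈ D.eigenspace (μ i : ℝ) := by
    intro i
    rw [Module.End.mem_eigenspace_iff]
    fin_cases i
    exacts [hD h0, hD h1, hD h2, hD h3, hD h4, hD h5, hD h6]
  exact (iSupIndep_iff_finsetSum_eq_zero_imp_eq_zero _).1 (D.eigenspaces_iSupIndep.comp hμ)
    Finset.univ w (fun i _ => hmem i) h i (Finset.mem_univ i)

/-- A representation with the weights of the model is isomorphic to the model. The summand of
symmetric or hermitian forms is given by a space `S` together with its matrix map `mat`. -/
theorem HasModelWeights.exists_equiv [FiniteDimensional ℝ W] (hR : IsGlRep R)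
    (hM : HasModelWeights R) {S : Type*} [AddCommGroup S] [Module ℝ S]
    (mat : S →ₗ[ℝ] Matrix (Fin 3) (Fin 3) 𝕜) (hinj : Function.Injective mat)
    (hmat : ∀ s, (mat s)ᴴ = mat s) (hsurj : ∃ s, mat s = Matrix.single 2 2 1)
    (τ : Matrix (Fin 3) (Fin 3) 𝕜 → S → S)
    (hτ : ∀ x s, mat (τ x s) = -(xᴴ * mat s + mat s * x)) :
    ∃ (k m : ℕ) (e : (S × (Fin k → Fin 3 → 𝕜) × (Fin m → ℝ)) ≃ₗ[ℝ] W),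
      ∀ x : Matrix (Fin 3) (Fin 3) 𝕜, x.trace = 0 → ∀ s a b,
        e (τ x s, fun j => x *ᵥ a j, 0) = R x (e (s, a, b)) := by
  obtain ⟨v, hvm, hv0, hvs⟩ := hM.exists_span
  have hv : IsHighest R v := ⟨hvm, hv0, hvs⟩
  obtain ⟨k, κ, hκ, hκi, hκs⟩ := hM.exists_stdHighest_basis hR
  let β := Module.finBasis ℝ (wt R 0 0)
  let m := Module.finrank ℝ (wt R 0 0)
  let Ψ : (S × (Fin k → Fin 3 → 𝕜) × (Fin m → ℝ)) →ₗ[ℝ] W :=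
    (hermMap R v ∘ₗ mat).coprod ((∑ j, stdMap R (κ j) ∘ₗ LinearMap.proj j).coprod
      (∑ j, (LinearMap.proj j).smulRight (β j : W)))
  have hΨ : ∀ s a b, Ψ (s, a, b) =
      hermMap R v (mat s) + (∑ j, stdMap R (κ j) (a j) + ∑ j, b j • (β j : W)) := by
    intro s a b
    simp [Ψ, LinearMap.coprod_apply, LinearMap.sum_apply]
  have hact : ∀ x : Matrix (Fin 3) (Fin 3) 𝕜, x.trace = 0 → ∀ s a b,
      Ψ (τ x s, fun j => x *ᵥ a j, 0) = R x (Ψ (s, a, b)) := by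
    intro x hx s a b
    rw [hΨ, hΨ, hτ, hv.hermMap_act hR hM hx (hmat s), map_add, map_add, map_sum, map_sum]
    congr 2
    · exact Finset.sum_congr rfl fun j _ => hM.stdMap_act hR (hκ j) hx _
    · rw [Finset.sum_eq_zero, Finset.sum_eq_zero]
      · intro j _
        rw [map_smul, hM.act_eq_zero hR (β j).2 hx, smul_zero]
      · intro j _
        simp
  have hW₀ : ∀ b : Fin m → ℝ, ∑ j, b j • (β j : W) ∈ wt R 0 0 := fun b =>
    sum_mem fun j _ => Submodule.smul_mem _ _ (β j).2
  -- The weight components of the image of a vector in the kernel vanish.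
  have hker : ∀ s a b, Ψ (s, a, b) = 0 → mat s 2 1 = 0 ∧ (∀ j, a j 0 = 0) ∧ b = 0 ∧
      ∀ i, mat s i i = 0 := by
    intro s a b h
    have hlow : ∀ {p : Fin 3}, p ≠ 2 → X 2 p 1 (X 2 p 1 v) ≠ 0 := by
      intro p hp h0
      have h1 := hv.raise_lower_lower_one hR hM hp 1
      have h2 := hv.raise_lower hR hM hp 1 1
      rw [h0, map_zero, map_one, eq_comm, smul_eq_zero, or_iff_right two_ne_zero] at h1
      rw [h1, map_zero, eq_comm, smul_eq_zero] at h2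
      simp [hv0] at h2
    have hreal : ∀ i, RCLike.re (mat s i i) = 0 → mat s i i = 0 := fun i hi => by
      have hconj : conj (mat s i i) = mat s i i := congrFun₂ (hmat s) i i
      rw [← RCLike.conj_eq_iff_re.1 hconj, hi, RCLike.ofReal_zero]
    let w : Fin 7 → W := ![∑ j, b j • (β j : W),
      -X 2 1 (mat s 2 1) v + ∑ j, H 0 1 (a j 0) (κ j),
      -X 2 0 (mat s 2 0) v + ∑ j, X 1 0 (a j 1) (κ j),
      X 2 0 (mat s 1 0) (X 2 1 1 v) + ∑ j, X 2 0 (a j 2) (κ j),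
      (RCLike.re (mat s 0 0) / 2) • X 2 0 1 (X 2 0 1 v),
      (RCLike.re (mat s 1 1) / 2) • X 2 1 1 (X 2 1 1 v),
      RCLike.re (mat s 2 2) • v]
    have hw : ∑ i, w i = 0 := by
      rw [hΨ, hermMap_apply] at h
      simp only [stdMap_apply, Finset.sum_add_distrib] at h
      rw [Fin.sum_univ_seven, ← h]
      simp only [w, cons_val]
      abel
    have hz := eq_zero_of_sum_eq_zero (w := w) (hW₀ b)
      (add_mem (neg_mem (hR.lower_mem hvm _))
        (sum_mem fun j _ => hR.cartanAct_mem 0 1 _ (hκ j).1))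
      (add_mem (neg_mem (hR.elemAct_mem 2 0 _ hvm (by decide)))
        (sum_mem fun j _ => hR.elemAct_mem 1 0 _ (hκ j).1 (by decide)))
      (add_mem (hR.elemAct_mem 2 0 _ (hR.lower_mem hvm _) (by decide))
        (sum_mem fun j _ => hR.elemAct_mem 2 0 _ (hκ j).1 (by decide)))
      (Submodule.smul_mem _ _ (hR.elemAct_mem 2 0 _ (hR.elemAct_mem 2 0 _ hvm rfl) (by decide)))
      (Submodule.smul_mem _ _ (hR.elemAct_mem 2 1 _ (hR.lower_mem hvm _) (by decide)))
      (Submodule.smul_mem _ _ hvm) hw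
    have h0 : ∑ j, b j • (β j : W) = 0 := hz 0
    have h1 : -X 2 1 (mat s 2 1) v + ∑ j, H 0 1 (a j 0) (κ j) = 0 := hz 1
    have h21 : mat s 2 1 = 0 := by
      have e1 := congrArg (X 1 2 (conj (mat s 2 1))) h1
      rw [map_add, map_neg, hv.raise_lower hR hM (by decide), map_sum, map_zero,
        Finset.sum_eq_zero fun j _ => (hR.cartanAct_mem_stdHighest (hκ j) _).2 _, add_zero,
        neg_eq_zero, smul_eq_zero, or_iff_left hv0, RCLike.conj_mul, ← RCLike.ofReal_pow,
        RCLike.ofReal_re] at e1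
      simpa using e1
    refine ⟨h21, fun j => ?_, ?_, fun i => hreal i ?_⟩
    · rw [h21, map_zero, LinearMap.zero_apply, neg_zero, zero_add] at h1
      exact congrFun (hκi _ h1) j
    · refine funext (Fintype.linearIndependent_iff.1 β.linearIndependent b (Subtype.ext ?_))
      rw [Submodule.coe_sum]
      exact h0
    · have h4 : (RCLike.re (mat s 0 0) / 2) • X 2 0 1 (X 2 0 1 v) = 0 := hz 4
      have h5 : (RCLike.re (mat s 1 1) / 2) • X 2 1 1 (X 2 1 1 v) = 0 := hz 5
      have h6 : RCLike.re (mat s 2 2) • v = 0 := hz 6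
      rw [smul_eq_zero, or_iff_left (hlow (by decide))] at h4 h5
      rw [smul_eq_zero, or_iff_left hv0] at h6
      fin_cases i
      · exact (div_eq_zero_iff.1 h4).resolve_right two_ne_zero
      · exact (div_eq_zero_iff.1 h5).resolve_right two_ne_zero
      · exact h6
  -- The kernel is stable under `sl₃`: the entries not controlled by `hker` are brought to a
  -- controlled position by `E₀₁` and `E₀₂`.
  have hΨinj : Function.Injective Ψ := by
    rw [← LinearMap.ker_eq_bot, LinearMap.ker_eq_bot']
    rintro ⟨s, a, b⟩ h
    have hx : ∀ x : Matrix (Fin 3) (Fin 3) 𝕜, x.trace = 0 →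
        Ψ (τ x s, fun j => x *ᵥ a j, 0) = 0 := fun x hx => by rw [hact x hx s a b, h, map_zero]
    obtain ⟨h21, ha0, hb, hd⟩ := hker _ _ _ h
    obtain ⟨h20, ha1, -⟩ := hker _ _ _ (hx (Matrix.single 0 1 1) (by simp))
    obtain ⟨h10, ha2, -⟩ := hker _ _ _ (hx (Matrix.single 0 2 1) (by simp))
    have hA' : ∀ i j, mat s i j = conj (mat s j i) := fun i j => congrFun₂ (hmat s).symm i j
    have h20' : mat s 2 0 = 0 := by
      simpa [hτ, Matrix.mul_apply, Matrix.single_apply] using h20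
    have h10' : mat s 1 0 = 0 := by
      rw [hA']
      simpa [hτ, Matrix.mul_apply, Matrix.single_apply] using h10
    have hs : s = 0 := by
      refine hinj ?_
      rw [map_zero]
      ext i j
      fin_cases i <;> fin_cases j <;>
        simp [hd, h21, h20', h10', hA' 0 1, hA' 0 2, hA' 1 2]
    have ha : a = 0 := by
      ext j i
      fin_cases i
      · exact ha0 j
      · simpa [Matrix.mulVec, dotProduct, Matrix.single_apply] using ha1 j
      · simpa [Matrix.mulVec, dotProduct, Matrix.single_apply] using ha2 j
    rw [hs, ha, hb]
    rfl
  have hΨsurj : Function.Surjective Ψ := by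
    rw [← LinearMap.range_eq_top]
    refine hv.eq_top hR hM _ ?_ ?_ ?_ ?_
    · rintro i j z hij _ ⟨⟨s, a, b⟩, rfl⟩
      exact ⟨_, hact (Matrix.single i j z) (by simp [hij]) s a b⟩
    · obtain ⟨s, hs⟩ := hsurj
      refine ⟨(s, 0, 0), ?_⟩
      rw [hΨ, hs]
      simp [hermMap_apply]
    · intro w hw
      obtain ⟨c, rfl⟩ := hκs w hw
      refine ⟨(0, fun j => Pi.single 0 (c j), 0), ?_⟩
      rw [hΨ]
      simp [stdMap_apply]
    · intro w hw
      refine ⟨(0, 0, β.repr ⟨w, hw⟩), ?_⟩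
      rw [hΨ]
      have := congrArg Subtype.val (β.sum_repr ⟨w, hw⟩)
      rw [Submodule.coe_sum] at this
      rw [show ∑ j, (β.repr ⟨w, hw⟩) j • (β j : W) = w from this]
      simp
  exact ⟨k, m, LinearEquiv.ofBijective Ψ ⟨hΨinj, hΨsurj⟩, hact⟩

end Model

/-! ### Passage between `sl₃` and `gl₃` -/

section Extension

variable {𝕜 W : Type*} [RCLike 𝕜] [AddCommGroup W] [Module ℝ W]

/-- The projection `x ↦ x - (tr x / 3) 1` of `gl₃(𝕜)` onto `sl₃(𝕜)`. -/
noncomputable def tracelessPart : Matrix (Fin 3) (Fin 3) 𝕜 →ₗ[ℝ] sl (Fin 3) 𝕜 where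
  toFun x := ⟨x - (x.trace / 3) • 1, by
    change (x - (x.trace / 3) • (1 : Matrix (Fin 3) (Fin 3) 𝕜)).trace = 0
    simp [Matrix.trace_sub, Matrix.trace_smul]⟩
  map_add' x y := Subtype.ext <| by
    change x + y - ((x + y).trace / 3) • 1 = (x - (x.trace / 3) • 1) + (y - (y.trace / 3) • 1)
    rw [Matrix.trace_add, add_div, add_smul]; abel
  map_smul' t x := Subtype.ext <| by
    change t • x - ((t • x).trace / 3) • 1 = t • (x - (x.trace / 3) • (1 : Matrix _ _ 𝕜))
    rw [Matrix.trace_smul, smul_sub, smul_div_assoc, smul_assoc]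

lemma coe_tracelessPart (x : Matrix (Fin 3) (Fin 3) 𝕜) :
    (tracelessPart x : Matrix (Fin 3) (Fin 3) 𝕜) = x - (x.trace / 3) • 1 := rfl

lemma tracelessPart_coe (x : sl (Fin 3) 𝕜) : tracelessPart (x : Matrix (Fin 3) (Fin 3) 𝕜) = x := by
  have hx : (x : Matrix (Fin 3) (Fin 3) 𝕜).trace = 0 := x.2
  exact Subtype.ext (by simp [coe_tracelessPart, hx])

lemma tracelessPart_commutator (x y : Matrix (Fin 3) (Fin 3) 𝕜) :
    tracelessPart (x * y - y * x) = ⁅tracelessPart x, tracelessPart y⁆ := by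
  refine Subtype.ext ?_
  rw [LieSubalgebra.coe_bracket, LieRing.of_associative_ring_bracket, coe_tracelessPart,
    coe_tracelessPart, coe_tracelessPart, Matrix.trace_sub, Matrix.trace_mul_comm, sub_self,
    zero_div, zero_smul, sub_zero]
  simp only [sub_mul, mul_sub, smul_mul_assoc, mul_smul_comm, one_mul, mul_one, smul_sub]
  rw [smul_comm (y.trace / 3)]
  abel

variable {ψ : sl (Fin 3) 𝕜 →ₗ[ℝ] Module.End ℝ W}

lemma isGlRep_comp_tracelessPart (hψ : ∀ x y, ψ ⁅x, y⁆ = ⁅ψ x, ψ y⁆) :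
    IsGlRep (ψ ∘ₗ tracelessPart) := fun x y w => by
  simp [tracelessPart_commutator, hψ, LieRing.of_associative_ring_bracket]

/-- A faithful representation of `sl₃(𝕜)` with an invariant symmetric product that vanishes on
no plane has the weights of the model, possibly after the twist by `x ↦ -xᵀ`. -/
theorem hasModelWeights_comp_tracelessPart [FiniteDimensional ℝ W]
    (hψ : ∀ x y, ψ ⁅x, y⁆ = ⁅ψ x, ψ y⁆) (hinj : Function.Injective ψ)
    {cup : W →ₗ[ℝ] W →ₗ[ℝ] Module.Dual ℝ W} (hsymm : ∀ u v, cup u v = cup v u)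
    (hequiv : ∀ x u v w, cup (ψ x u) v w + cup u (ψ x v) w + cup u v (ψ x w) = 0)
    (hplane : ∀ P : Submodule ℝ W, Module.finrank ℝ P = 2 → ∃ u ∈ P, ∃ v ∈ P, cup u v ≠ 0) :
    HasModelWeights (ψ ∘ₗ tracelessPart) ∨
      HasModelWeights (negTransposeRep (ψ ∘ₗ tracelessPart)) := by
  refine IsCup.hasModelWeights (cup := cup) (isGlRep_comp_tracelessPart hψ)
    ⟨hsymm, fun x => hequiv (tracelessPart x), fun u v huv => ?_⟩ fun h => ?_
  · by_contra! h
    obtain ⟨h₁, h₂, h₃⟩ := h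
    obtain ⟨p, hp, q, hq, hpq⟩ := hplane (Submodule.span ℝ (Set.range ![u, v]))
      (by rw [finrank_span_eq_card huv, Fintype.card_fin])
    rw [Matrix.range_cons_cons_empty] at hp hq
    obtain ⟨a, b, rfl⟩ := Submodule.mem_span_pair.1 hp
    obtain ⟨c, d, rfl⟩ := Submodule.mem_span_pair.1 hq
    exact hpq (by simp [h₁, h₂, h₃, hsymm v u])
  · have h₀ := (injective_iff_map_eq_zero ψ).1 hinj _ h
    have h₁ := congrFun₂ (congrArg Subtype.val h₀) 0 1
    simp [coe_tracelessPart] at h₁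

end Extension

/-! ### Gram matrices of quadratic and hermitian forms -/

section Gram

/-- The symmetric matrix of a quadratic form. -/
noncomputable def quadMatrix :
    QuadraticForm ℝ (Fin 3 → ℝ) →ₗ[ℝ] Matrix (Fin 3) (Fin 3) ℝ :=
  (LinearMap.toMatrix₂' ℝ).toLinearMap ∘ₗ QuadraticMap.associated

lemma quadMatrix_injective : Function.Injective quadMatrix :=
  (LinearMap.toMatrix₂' ℝ).injective.comp (QuadraticMap.associated_rightInverse ℝ).injective

lemma conjTranspose_quadMatrix (q : QuadraticForm ℝ (Fin 3 → ℝ)) :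
    (quadMatrix q)ᴴ = quadMatrix q := by
  ext i j
  simp [quadMatrix, LinearMap.toMatrix₂'_apply, QuadraticMap.associated_apply, add_comm]
  ring

lemma exists_quadMatrix_eq_single : ∃ q, quadMatrix q = Matrix.single 2 2 1 := by
  refine ⟨LinearMap.BilinMap.toQuadraticMap (Matrix.toLinearMap₂' ℝ (Matrix.single 2 2 1)), ?_⟩
  rw [quadMatrix, LinearMap.comp_apply, QuadraticMap.associated_left_inverse,
    LinearEquiv.coe_coe, LinearMap.toMatrix'_toLinearMap₂']
  intro u v
  simp [Matrix.toLinearMap₂'_apply, Fin.sum_univ_three, mul_comm]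

lemma quadMatrix_quadAct (x : Matrix (Fin 3) (Fin 3) ℝ) (q : QuadraticForm ℝ (Fin 3 → ℝ)) :
    quadMatrix (quadAct x q) = -(xᴴ * quadMatrix q + quadMatrix q * x) := by
  have h : QuadraticMap.associated (quadAct x q) =
      -((QuadraticMap.associated q).comp x.mulVecLin
        + (QuadraticMap.associated q).compl₂ x.mulVecLin) := by
    refine LinearMap.ext₂ fun u v => ?_
    have hs : QuadraticMap.associated q (x *ᵥ v) u = QuadraticMap.associated q u (x *ᵥ v) :=
      QuadraticMap.associated_isSymm ℝ q _ _
    have hp : ∀ (p : QuadraticForm ℝ (Fin 3 → ℝ)) a b,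
        p.polarBilin a b = 2 * QuadraticMap.associated p a b := fun p a b => by
      rw [← QuadraticMap.two_nsmul_associated ℝ, LinearMap.smul_apply, LinearMap.smul_apply,
        nsmul_eq_mul, Nat.cast_ofNat]
    have h := hp (quadAct x q) u v
    simp only [QuadraticMap.polarBilin_apply_apply (quadAct x q), QuadraticMap.polar,
      quadAct_apply, hp, Matrix.mulVec_add, map_add, LinearMap.add_apply, hs] at h
    simp only [LinearMap.neg_apply, LinearMap.add_apply, LinearMap.comp_apply,
      LinearMap.compl₂_apply, Matrix.mulVecLin_apply]
    linarith
  rw [quadMatrix, LinearMap.comp_apply, LinearMap.comp_apply, h]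
  refine (map_neg (LinearMap.toMatrix₂' ℝ : ((Fin 3 → ℝ) →ₗ[ℝ] (Fin 3 → ℝ) →ₗ[ℝ] ℝ) ≃ₗ[ℝ]
    Matrix (Fin 3) (Fin 3) ℝ) _).trans (congrArg _ ?_)
  rw [map_add, LinearMap.toMatrix₂'_comp, LinearMap.toMatrix₂'_compl₂, ← Matrix.toLin'_apply',
    LinearMap.toMatrix'_toLin', Matrix.conjTranspose_eq_transpose_of_trivial]
  rfl

/-- The Gram matrix of a hermitian form. -/
noncomputable def herMatrix : HerForms →ₗ[ℝ] Matrix (Fin 3) (Fin 3) ℂ where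
  toFun H := Matrix.of fun i j => H.1 (Pi.single i 1) (Pi.single j 1)
  map_add' _ _ := rfl
  map_smul' _ _ := rfl

lemma herMatrix_apply (H : HerForms) (i j : Fin 3) :
    herMatrix H i j = H.1 (Pi.single i 1) (Pi.single j 1) := rfl

lemma herForms_apply (H : HerForms) (v w : Fin 3 → ℂ) :
    H.1 v w = ∑ i, ∑ j, conj (v i) * (herMatrix H i j * w j) := by
  conv_lhs => rw [pi_eq_sum_univ' v, pi_eq_sum_univ' w]
  simp only [map_sum, LinearMap.sum_apply, LinearMap.map_smulₛₗ, LinearMap.smul_apply,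
    smul_eq_mul, RingHom.id_apply, herMatrix_apply]
  simp [Fin.sum_univ_three]
  ring

lemma herMatrix_injective : Function.Injective herMatrix := fun H H' h =>
  Subtype.ext <| LinearMap.ext₂ fun v w => by rw [herForms_apply, herForms_apply, h]

lemma conjTranspose_herMatrix (H : HerForms) : (herMatrix H)ᴴ = herMatrix H :=
  Matrix.ext fun _ _ => (H.2 _ _).symm

lemma exists_herMatrix_eq_single : ∃ H, herMatrix H = Matrix.single 2 2 1 := by
  let h : (Fin 3 → ℂ) →ₗ⋆[ℂ] (Fin 3 → ℂ) →ₗ[ℂ] ℂ :=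
    LinearMap.mk₂'ₛₗ (starRingEnd ℂ) (RingHom.id ℂ) (fun v w => conj (v 2) * w 2)
    (fun u v w => by simp [add_mul]) (fun c v w => by simp [mul_assoc])
    (fun u v w => by simp [mul_add]) (fun c v w => by simp [mul_left_comm])
  have hh : ∀ v w, h v w = conj (v 2) * w 2 := fun _ _ => rfl
  refine ⟨⟨h, fun v w => by simp [hh, mul_comm]⟩, ?_⟩
  · ext i j
    change h (Pi.single i 1) (Pi.single j 1) = _
    rw [hh]
    fin_cases i <;> fin_cases j <;> simp

/-- The action of a matrix on the space of hermitian forms. -/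
def herAct (x : Matrix (Fin 3) (Fin 3) ℂ) (H : HerForms) : HerForms :=
  ⟨sesqAct x H.1, fun v w => by
    simp only [sesqAct_apply, map_sub, map_neg]
    rw [H.2 (x *ᵥ v) w, H.2 v (x *ᵥ w)]; ring⟩

lemma herMatrix_herAct (x : Matrix (Fin 3) (Fin 3) ℂ) (H : HerForms) :
    herMatrix (herAct x H) = -(xᴴ * herMatrix H + herMatrix H * x) := by
  ext i j
  change -H.1 (x *ᵥ Pi.single i 1) (Pi.single j 1) - H.1 (Pi.single i 1) (x *ᵥ Pi.single j 1) = _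
  rw [herForms_apply, herForms_apply]
  simp [Matrix.mul_apply, Pi.single_apply]
  ring

end Gram

/-! ### Identification with the model representations -/

section Model

variable {W : Type*} [AddCommGroup W] [Module ℝ W] [FiniteDimensional ℝ W]

lemma HasModelWeights.exists_modelR_equiv
    {R : Matrix (Fin 3) (Fin 3) ℝ →ₗ[ℝ] Module.End ℝ W} (hM : HasModelWeights R)
    (hR : IsGlRep R) :
    ∃ (k m : ℕ) (e : (QuadraticForm ℝ (Fin 3 → ℝ) × (Fin k → Fin 3 → ℝ) × (Fin m → ℝ)) ≃ₗ[ℝ] W),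
      ∀ y u, e (modelR k m y u) = R y.1 (e u) := by
  obtain ⟨k, m, e, he⟩ := hM.exists_equiv hR quadMatrix quadMatrix_injective
    conjTranspose_quadMatrix exists_quadMatrix_eq_single quadAct quadMatrix_quadAct
  exact ⟨k, m, e, fun y u => he y.1 y.2 u.1 u.2.1 u.2.2⟩

/-- As a real representation `E_ℂ` is isomorphic to its conjugate through `v ↦ conj v`, so that no
conjugate summand is needed. -/
lemma HasModelWeights.exists_modelC_equiv
    {R : Matrix (Fin 3) (Fin 3) ℂ →ₗ[ℝ] Module.End ℝ W} (hM : HasModelWeights R)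
    (hR : IsGlRep R) :
    ∃ (k m : ℕ)
      (e : (HerForms × (Fin k → Fin 3 → ℂ) × (Fin 0 → Fin 3 → ℂ) × (Fin m → ℝ)) ≃ₗ[ℝ] W),
      ∀ y u, e (modelC k 0 m y u) = R y.1 (e u) := by
  obtain ⟨k, m, e, he⟩ := hM.exists_equiv hR herMatrix herMatrix_injective
    conjTranspose_herMatrix exists_herMatrix_eq_single herAct herMatrix_herAct
  exact ⟨k, m, (LinearEquiv.prodCongr (LinearEquiv.refl ℝ _)
      (LinearEquiv.prodCongr (LinearEquiv.refl ℝ _) LinearEquiv.uniqueProd)).trans e,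
    fun y u => he y.1 y.2 u.1 u.2.1 u.2.2.2⟩

/-- The positive definite form `tr(A A') + ∑ ⟨aⱼ, a'ⱼ⟩ + ⟨b, b'⟩` on the space of
`Sym₂(E*) ⊕ E^k ⊕ T^m`. -/
noncomputable def modelForm (k m : ℕ) :
    (QuadraticForm ℝ (Fin 3 → ℝ) × (Fin k → Fin 3 → ℝ) × (Fin m → ℝ)) →ₗ[ℝ]
      Module.Dual ℝ (QuadraticForm ℝ (Fin 3 → ℝ) × (Fin k → Fin 3 → ℝ) × (Fin m → ℝ)) :=
  LinearMap.mk₂ ℝ (fun u u' => (quadMatrix u.1 * quadMatrix u'.1).trace +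
      (∑ j, u.2.1 j ⬝ᵥ u'.2.1 j + u.2.2 ⬝ᵥ u'.2.2))
    (fun u u' w => by
      simp only [Prod.fst_add, Prod.snd_add, map_add, add_mul, Matrix.trace_add, Pi.add_apply,
        add_dotProduct, Finset.sum_add_distrib]
      ring)
    (fun c u w => by
      simp only [Prod.smul_fst, Prod.smul_snd, map_smul, smul_mul_assoc, Matrix.trace_smul,
        Pi.smul_apply, smul_dotProduct, smul_add, Finset.smul_sum])
    (fun w u u' => by
      simp only [Prod.fst_add, Prod.snd_add, map_add, mul_add, Matrix.trace_add, Pi.add_apply,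
        dotProduct_add, Finset.sum_add_distrib]
      ring)
    (fun c w u => by
      simp only [Prod.smul_fst, Prod.smul_snd, map_smul, mul_smul_comm, Matrix.trace_smul,
        Pi.smul_apply, dotProduct_smul, smul_add, Finset.smul_sum])

lemma modelForm_apply {k m : ℕ}
    (u u' : QuadraticForm ℝ (Fin 3 → ℝ) × (Fin k → Fin 3 → ℝ) × (Fin m → ℝ)) :
    modelForm k m u u' = (quadMatrix u.1 * quadMatrix u'.1).trace +
      (∑ j, u.2.1 j ⬝ᵥ u'.2.1 j + u.2.2 ⬝ᵥ u'.2.2) := rfl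

lemma modelForm_injective (k m : ℕ) : Function.Injective (modelForm k m) := by
  refine (injective_iff_map_eq_zero _).2 fun u hu => ?_
  have h := LinearMap.congr_fun hu u
  have hA := Matrix.posSemidef_conjTranspose_mul_self (quadMatrix u.1)
  have h₁ : 0 ≤ (quadMatrix u.1 * quadMatrix u.1).trace := by
    simpa only [conjTranspose_quadMatrix] using hA.trace_nonneg
  have h₂ : ∀ j, 0 ≤ u.2.1 j ⬝ᵥ u.2.1 j := fun j =>
    Finset.sum_nonneg fun _ _ => mul_self_nonneg _
  have h₃ : 0 ≤ u.2.2 ⬝ᵥ u.2.2 := Finset.sum_nonneg fun _ _ => mul_self_nonneg _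
  have h₂' := Finset.sum_nonneg fun j (_ : j ∈ Finset.univ) => h₂ j
  rw [modelForm_apply, LinearMap.zero_apply] at h
  have hq : quadMatrix u.1 = 0 := by
    rw [← Matrix.trace_conjTranspose_mul_self_eq_zero_iff, conjTranspose_quadMatrix]
    linarith
  have ha : ∀ j, u.2.1 j = 0 := fun j => dotProduct_self_eq_zero.1 <|
    (Finset.sum_eq_zero_iff_of_nonneg fun j _ => h₂ j).1 (by linarith) j (Finset.mem_univ j)
  exact Prod.ext (quadMatrix_injective (hq.trans (map_zero _).symm))
    (Prod.ext (funext ha) (dotProduct_self_eq_zero.1 (by linarith)))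

/-- The form `modelForm` is invariant if one of the two factors is twisted by `y ↦ -yᵀ`. -/
lemma modelForm_modelR {k m : ℕ} {y z : sl (Fin 3) ℝ} (hyz : z.1 = -y.1ᵀ)
    (u u' : QuadraticForm ℝ (Fin 3 → ℝ) × (Fin k → Fin 3 → ℝ) × (Fin m → ℝ)) :
    modelForm k m (modelR k m z u) u' = -modelForm k m u (modelR k m y u') := by
  have h₁ : ∀ x : sl (Fin 3) ℝ, modelR k m x u = (quadAct x.1 u.1, fun j => x.1 *ᵥ u.2.1 j, 0) :=
    fun _ => rfl
  have h₂ : ∀ x : sl (Fin 3) ℝ,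
      modelR k m x u' = (quadAct x.1 u'.1, fun j => x.1 *ᵥ u'.2.1 j, 0) := fun _ => rfl
  rw [h₁, h₂, modelForm_apply, modelForm_apply, hyz]
  simp only [quadMatrix_quadAct, Matrix.conjTranspose_eq_transpose_of_trivial,
    Matrix.transpose_neg, Matrix.transpose_transpose, neg_mul, mul_neg, neg_neg, neg_add, add_mul,
    mul_add, Matrix.trace_add, Matrix.trace_neg, Matrix.neg_mulVec, neg_dotProduct,
    Finset.sum_neg_distrib, zero_dotProduct, dotProduct_zero, add_zero]
  rw [mul_assoc, Matrix.trace_mul_comm y.1, mul_assoc, mul_assoc,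
    add_comm (Matrix.trace _)]
  congr 2
  refine Finset.sum_congr rfl fun j _ => ?_
  rw [Matrix.dotProduct_mulVec, Matrix.mulVec_transpose]

end Model

/-- The automorphism `x ↦ -xᵀ` of the real Lie algebra `sl₃(ℂ)`. -/
noncomputable def negTransposeSlC : sl (Fin 3) ℂ ≃ₗ⁅ℝ⁆ sl (Fin 3) ℂ where
  toFun x := ⟨-x.1ᵀ, by
    have hx : x.1.trace = 0 := x.2
    change (-x.1ᵀ).trace = 0
    rw [Matrix.trace_neg, Matrix.trace_transpose, hx, neg_zero]⟩
  invFun x := ⟨-x.1ᵀ, by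
    have hx : x.1.trace = 0 := x.2
    change (-x.1ᵀ).trace = 0
    rw [Matrix.trace_neg, Matrix.trace_transpose, hx, neg_zero]⟩
  map_add' x y := Subtype.ext <| by
    change -(x.1 + y.1)ᵀ = -x.1ᵀ + -y.1ᵀ
    rw [Matrix.transpose_add, neg_add]
  map_smul' t x := Subtype.ext <| by
    change -(t • x.1)ᵀ = t • -x.1ᵀ
    rw [Matrix.transpose_smul, smul_neg]
  map_lie' {x y} := Subtype.ext <| by
    change -(x.1 * y.1 - y.1 * x.1)ᵀ = -x.1ᵀ * -y.1ᵀ - -y.1ᵀ * -x.1ᵀ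
    simp [Matrix.transpose_mul]
  left_inv x := Subtype.ext <| by
    change -(-x.1ᵀ)ᵀ = x.1
    simp
  right_inv x := Subtype.ext <| by
    change -(-x.1ᵀ)ᵀ = x.1
    simp

section Classification

variable {g W : Type*} [LieRing g] [LieAlgebra ℝ g]
  [AddCommGroup W] [Module ℝ W] [FiniteDimensional ℝ W]

/-- In the second case of `hasModelWeights_comp_tracelessPart`, `W` is the model twisted by
`x ↦ -xᵀ`, which `modelForm` identifies with the dual of the model. -/
theorem exists_repIso_modelR
    (ρ : g →ₗ⁅ℝ⁆ Module.End ℝ W) (hρ : Function.Injective ρ)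
    {cup : W →ₗ[ℝ] W →ₗ[ℝ] Module.Dual ℝ W} (hsymm : ∀ u v, cup u v = cup v u)
    (hinv : ∀ x u v w, cup (ρ x u) v w + cup u (ρ x v) w + cup u v (ρ x w) = 0)
    (hplane : ∀ P : Submodule ℝ W, Module.finrank ℝ P = 2 → ∃ u ∈ P, ∃ v ∈ P, cup u v ≠ 0)
    (φ : g ≃ₗ⁅ℝ⁆ sl (Fin 3) ℝ) :
    ∃ k m : ℕ, RepIso ρ ((modelR k m).comp φ.toLieHom) ∨
      RepIso ρ ((dualRep (modelR k m)).comp φ.toLieHom) := by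
  let ψ : sl (Fin 3) ℝ →ₗ[ℝ] Module.End ℝ W := (ρ.comp φ.symm.toLieHom).toLinearMap
  have hψ : ∀ x y, ψ ⁅x, y⁆ = ⁅ψ x, ψ y⁆ := (ρ.comp φ.symm.toLieHom).map_lie
  have hψρ : ∀ x, (ψ ∘ₗ tracelessPart) (φ x).1 = ρ x := fun x => by
    rw [LinearMap.comp_apply, tracelessPart_coe]
    exact congrArg ρ (φ.symm_apply_apply x)
  have hR := isGlRep_comp_tracelessPart hψ
  rcases hasModelWeights_comp_tracelessPart hψ (hρ.comp φ.symm.injective) hsymm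
    (fun x => hinv (φ.symm x)) hplane with hM | hM
  · obtain ⟨k, m, e, he⟩ := hM.exists_modelR_equiv hR
    refine ⟨k, m, Or.inl ⟨e.symm, fun x v => e.symm_apply_eq.2 ?_⟩⟩
    change _ = e (modelR k m (φ x) (e.symm v))
    rw [he, e.apply_symm_apply, hψρ]
  · obtain ⟨k, m, e, he⟩ := hM.exists_modelR_equiv hR.negTranspose
    have := Module.Finite.equiv e.symm
    let B := LinearMap.linearEquivOfInjective (modelForm k m) (modelForm_injective k m)
      Subspace.dual_finrank_eq.symm
    refine ⟨k, m, Or.inr ⟨e.symm.trans B, fun x v => ?_⟩⟩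
    let z : sl (Fin 3) ℝ := ⟨-(φ x).1ᵀ, by
      have hx : (φ x).1.trace = 0 := (φ x).2
      change (-(φ x).1ᵀ).trace = 0
      rw [Matrix.trace_neg, Matrix.trace_transpose, hx, neg_zero]⟩
    have hz : e.symm (ρ x v) = modelR k m z (e.symm v) := by
      rw [e.symm_apply_eq, he, e.apply_symm_apply, negTransposeRep_apply, ← hψρ]
      simp [z]
    refine LinearMap.ext fun u' => ?_
    change modelForm k m (e.symm (ρ x v)) u' = -modelForm k m (e.symm v) (modelR k m (φ x) u')
    rw [hz]
    exact modelForm_modelR rfl _ _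

/-- The automorphism `σ` is either the identity or corresponds to `x ↦ -xᵀ`. -/
theorem exists_repIso_modelC
    (ρ : g →ₗ⁅ℝ⁆ Module.End ℝ W) (hρ : Function.Injective ρ)
    {cup : W →ₗ[ℝ] W →ₗ[ℝ] Module.Dual ℝ W} (hsymm : ∀ u v, cup u v = cup v u)
    (hinv : ∀ x u v w, cup (ρ x u) v w + cup u (ρ x v) w + cup u v (ρ x w) = 0)
    (hplane : ∀ P : Submodule ℝ W, Module.finrank ℝ P = 2 → ∃ u ∈ P, ∃ v ∈ P, cup u v ≠ 0)
    (φ : g ≃ₗ⁅ℝ⁆ sl (Fin 3) ℂ) :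
    ∃ (k m : ℕ) (σ : g ≃ₗ⁅ℝ⁆ g),
      RepIso (ρ.comp σ.toLieHom) ((modelC k 0 m).comp φ.toLieHom) := by
  let ψ : sl (Fin 3) ℂ →ₗ[ℝ] Module.End ℝ W := (ρ.comp φ.symm.toLieHom).toLinearMap
  have hψ : ∀ x y, ψ ⁅x, y⁆ = ⁅ψ x, ψ y⁆ := (ρ.comp φ.symm.toLieHom).map_lie
  have hψρ : ∀ x : sl (Fin 3) ℂ, (ψ ∘ₗ tracelessPart) x.1 = ρ (φ.symm x) := fun x => by
    rw [LinearMap.comp_apply, tracelessPart_coe]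
    rfl
  have hR := isGlRep_comp_tracelessPart hψ
  rcases hasModelWeights_comp_tracelessPart hψ (hρ.comp φ.symm.injective) hsymm
    (fun x => hinv (φ.symm x)) hplane with hM | hM
  · obtain ⟨k, m, e, he⟩ := hM.exists_modelC_equiv hR
    refine ⟨k, m, LieEquiv.refl, e.symm, fun x v => e.symm_apply_eq.2 ?_⟩
    change ρ x v = e (modelC k 0 m (φ x) (e.symm v))
    rw [he, e.apply_symm_apply, hψρ, φ.symm_apply_apply]
  · obtain ⟨k, m, e, he⟩ := hM.exists_modelC_equiv hR.negTranspose
    refine ⟨k, m, (φ.trans negTransposeSlC).trans φ.symm, e.symm,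
      fun x v => e.symm_apply_eq.2 ?_⟩
    change ρ (φ.symm (negTransposeSlC (φ x))) v = e (modelC k 0 m (φ x) (e.symm v))
    rw [he, e.apply_symm_apply, negTransposeRep_apply, ← hψρ, ← LinearMap.neg_apply, ← map_neg]
    rfl

end Classification

end RepSl3

theorem mainTheorem6 {g W : Type*} [LieRing g] [LieAlgebra ℝ g]
    [AddCommGroup W] [Module ℝ W] [FiniteDimensional ℝ W]
    (ρ : g →ₗ⁅ℝ⁆ Module.End ℝ W) (hρ : Function.Injective ρ)
    (cup : W →ₗ[ℝ] W →ₗ[ℝ] Module.Dual ℝ W)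
    (hsymm : ∀ u v : W, cup u v = cup v u)
    (hequiv : ∀ (x : g) (u v : W),
      RepSl3.dualRep ρ x (cup u v) = cup (ρ x u) v + cup u (ρ x v))
    (hplane : ∀ P : Submodule ℝ W, Module.finrank ℝ P = 2 → ∃ u ∈ P, ∃ v ∈ P, cup u v ≠ 0) :
    (∀ φ : g ≃ₗ⁅ℝ⁆ sl (Fin 3) ℝ, ∃ k m : ℕ,
      RepSl3.RepIso ρ ((RepSl3.modelR k m).comp φ.toLieHom) ∨
      RepSl3.RepIso ρ ((RepSl3.dualRep (RepSl3.modelR k m)).comp φ.toLieHom)) ∧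
    (∀ φ : g ≃ₗ⁅ℝ⁆ sl (Fin 3) ℂ, ∃ (k l m : ℕ) (σ : g ≃ₗ⁅ℝ⁆ g),
      RepSl3.RepIso (ρ.comp σ.toLieHom) ((RepSl3.modelC k l m).comp φ.toLieHom)) := by
  have hinv : ∀ x u v w, cup (ρ x u) v w + cup u (ρ x v) w + cup u v (ρ x w) = 0 :=
    fun x u v w => by
      have h : -cup u v (ρ x w) = cup (ρ x u) v w + cup u (ρ x v) w :=
        LinearMap.congr_fun (hequiv x u v) w
      rw [← h, neg_add_cancel]
  refine ⟨fun φ => RepSl3.exists_repIso_modelR ρ hρ hsymm hinv hplane φ, fun φ => ?_⟩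
  obtain ⟨k, m, σ, h⟩ := RepSl3.exists_repIso_modelC ρ hρ hsymm hinv hplane φ
  exact ⟨k, 0, m, σ, h⟩
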